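/- Let $L_2=\mathbb Z/2\wr\mathbb Z$ be the lamplighter group: its elements are pairs $(f,p)$ with $f:\mathbb Z\to\mathbb Z/2$ finitely supported (the lit bulbs) and $p\in\mathbb Z$ (the cursor), with $(f,p)(g,q)=(f+g(\cdot-p),\,p+q)$. Let $t=(0,1)$ (move the cursor one step to the right) and $a=(\delta_0,0)$ (toggle the bulb at the cursor). For a subset $S$ of a group, the full language of geodesics with respect to $S$ is the set of all words over the alphabet $S\cup S^{-1}$ that have minimal length among the words over $S\cup S^{-1}$ representing the same group element. For $k\ge 1$ a $\mathbb Z^k$-automaton over an alphabet $A$ is a finite directed graph with a start vertex, a set of accept vertices and edges labelled by elements of $(A\cup\{\epsilon\})\times\mathbb Z^k$; it accepts a word $w$ if some path from the start vertex to an accept vertex has first labels multiplying to $w$ and second labels summing to $0$. A language is $k$-counter if it is the set of words accepted by some $\mathbb Z^k$-automaton, and counter if it is $k$-counter for some $k\ge1$. Theorem. The full language of geodesics of $L_2$ with respect to the automata generating set $\{t,ta\}$ is $1$-counter (accepted by a $\mathbb Z$-automaton). Hence it is both context-free and counter. In contrast, the full language of geodesics of $L_2$ with respect to the wreath product generating set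 $\{a,t\}$ is not counter. -/

import Mathlib

/-- The shift action of `ℤ` on finitely supported functions `ℤ → ℤ/m`:
`n` sends the configuration `f` to `x ↦ f (x - n)`. -/
noncomputable def lampShift (m : ℕ) :
    Multiplicative ℤ →* MulAut (Multiplicative (ℤ →₀ ZMod m)) where
  toFun n := AddEquiv.toMultiplicative (Finsupp.domCongr (Equiv.addRight n.toAdd))
  map_one' := by
    ext f : 1
    apply Multiplicative.toAdd.injective
    ext x
    change (Multiplicative.toAdd f) (x + -0) = (Multiplicative.toAdd f) x
    rw [neg_zero, add_zero]
  map_mul' n k := by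
    ext f : 1
    apply Multiplicative.toAdd.injective
    ext x
    change (Multiplicative.toAdd f) (x + -(n.toAdd + k.toAdd)) =
      (Multiplicative.toAdd f) (x + -n.toAdd + -k.toAdd)
    congr 1
    ring

/-- The lamplighter group `L_m = ℤ/m ≀ ℤ` (restricted wreath product): pairs consisting of a
configuration of finitely many lit bulbs and a cursor position. -/
abbrev Lamplighter (m : ℕ) : Type :=
  Multiplicative (ℤ →₀ ZMod m) ⋊[lampShift m] Multiplicative ℤ

namespace Lamplighter

/-- The generator `a`: increment the bulb at the cursor. -/
noncomputable def a (m : ℕ) : Lamplighter m :=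
  SemidirectProduct.inl (Multiplicative.ofAdd (Finsupp.single 0 1))

/-- The generator `t`: move the cursor one step to the right. -/
noncomputable def t (m : ℕ) : Lamplighter m :=
  SemidirectProduct.inr (Multiplicative.ofAdd 1)

/-- The wreath product generating set `{a, t}`. -/
def wreathGens (m : ℕ) : Set (Lamplighter m) := {a m, t m}

/-- The automata generating set `{t, ta}` of `L_2`. -/
def automataGens : Set (Lamplighter 2) := {t 2, t 2 * a 2}

end Lamplighter

/-- The letters `S ∪ S⁻¹` used for words in a subset `S` of a group. -/
abbrev Letters {G : Type*} [Group G] (S : Set G) : Type _ := {g : G // g ∈ S ∨ g⁻¹ ∈ S}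

/-- The group element represented by a word in `S ∪ S⁻¹`. -/
def wordValue {G : Type*} [Group G] {S : Set G} (w : List (Letters S)) : G :=
  (w.map Subtype.val).prod

/-- A word is geodesic if no word in the same letters representing the same element is shorter. -/
def IsGeodesicWord {G : Type*} [Group G] {S : Set G} (w : List (Letters S)) : Prop :=
  ∀ v : List (Letters S), wordValue v = wordValue w → w.length ≤ v.length

/-- The full language of geodesics of a group with respect to `S`. -/
def fullGeodesicLanguage {G : Type*} [Group G] (S : Set G) : Language (Letters S) :=
  {w | IsGeodesicWord w}

/-- A (nondeterministic) `G`-automaton over the alphabet `A`: a finite directed graph with edges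
labelled by elements of `(A ∪ {ε}) × G`; the label `none` stands for `ε`. -/
structure GroupAutomaton (G : Type*) (A : Type*) where
  State : Type
  finite_state : Finite State
  edges : Set (State × Option A × G × State)
  finite_edges : edges.Finite
  start : State
  accept : Set State

namespace GroupAutomaton

variable {G A : Type*} [Group G]

/-- `M.Path q w g r`: there is a path from `q` to `r` with word `w` and group label `g`. -/
inductive Path (M : GroupAutomaton G A) : M.State → List A → G → M.State → Prop
  | nil (q : M.State) : Path M q [] 1 q
  | cons {q q' r : M.State} {x : Option A} {g h : G} {w : List A} :
      (q, x, g, q') ∈ M.edges → Path M q' w h r → Path M q (x.toList ++ w) (g * h) r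

/-- The accepted language: words labelling a path from the start vertex to an accept vertex whose
group label is trivial. -/
def language (M : GroupAutomaton G A) : Language A :=
  {w | ∃ q ∈ M.accept, M.Path M.start w 1 q}

end GroupAutomaton

/-- A language is `k`-counter if it is accepted by some `ℤ^k`-automaton. -/
def Language.IsKCounter {A : Type*} (k : ℕ) (L : Language A) : Prop :=
  ∃ M : GroupAutomaton (Multiplicative (Fin k → ℤ)) A, M.language = L

/-- A language is counter if it is `k`-counter for some `k ≥ 1`. -/
def Language.IsCounter {A : Type*} (L : Language A) : Prop :=
  ∃ k : ℕ, 1 ≤ k ∧ L.IsKCounter k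

/-! ### Words and geodesic words in a group -/

section WordValue

variable {G : Type*} [Group G] {S : Set G}

/-! For `{t, ta}`, put the lamps on the edges of the line: every letter crosses one edge and chooses
whether to toggle its lamp (`EdgeLamps`). Let `[m, M]` be an interval containing the origin, the
final cursor `c` and every lit edge. Walking to one end, sweeping to the other and returning
represents the element with `2(M - m) - |c|` letters (`exists_word`); conversely any word of value
`g` provides such an interval whose cost is at most its length (`exists_range`). So length in the
group is the least such cost.

It follows that geodesics are tours (`isGeodesicWord_iff`): a leg in direction `d`, a leg back that
is at least as long as the two outer legs together, and a leg in direction `d` again. The two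
letters at a turn must not cancel, so exactly one of them toggles; hence the turning edge is lit, no
interval can be shorter, and every such word is geodesic. The only non-regular condition is the
inequality `n + k ≤ |β|` between lengths. One counter checks it by counting down on the outer legs
and counting up, or not, on each letter of the middle leg. A grammar checks it by cutting the middle
leg into two pieces matched with the outer legs and a free piece between them.

For `{a, t}`, the tool is a swapping lemma (`exists_swap`): a path through many blocks visits one
state three times, and since labels commute the two loops between these visits may be exchanged. It
is applied to a word that goes right through the blocks `t ^ (i + 1) * a` and returns toggling
exactly the lamps skipped on the way out. It lights all lamps `1, …, T` with the least possible
number `3T` of letters. As the gaps are distinct, a swap changes the set of lamps toggled on the way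
out; it keeps length and cursor, but now some lamp among `1, …, T` ends unlit, and fewer than `3T`
letters suffice. So the swapped word is accepted without being geodesic. -/

theorem wordValue_nil : wordValue ([] : List (Letters S)) = 1 := rfl

theorem wordValue_append (u v : List (Letters S)) :
    wordValue (u ++ v) = wordValue u * wordValue v := by
  simp [wordValue]

theorem wordValue_singleton (x : Letters S) : wordValue [x] = x.1 := by
  simp [wordValue]

theorem wordValue_cons (x : Letters S) (v : List (Letters S)) :
    wordValue (x :: v) = x.1 * wordValue v := by
  simp [wordValue]

theorem IsGeodesicWord.of_append_left {u v : List (Letters S)} (h : IsGeodesicWord (u ++ v)) :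
    IsGeodesicWord u := by
  intro u' hu'
  have := h (u' ++ v) (by rw [wordValue_append, wordValue_append, hu'])
  simpa using this

theorem IsGeodesicWord.not_cancel {u v : List (Letters S)} {x y : Letters S}
    (h : IsGeodesicWord (u ++ x :: y :: v)) : x.1 * y.1 ≠ 1 := by
  intro hxy
  have := h (u ++ v) (by
    rw [wordValue_append, wordValue_append, wordValue_cons, wordValue_cons, ← mul_assoc x.1, hxy,
      one_mul])
  simp at this

end WordValue

/-! ### Lamps on edges: the length formula -/

/-- Coordinates on a group with generating set `S` in which every letter `s d b` moves a cursor
across an edge of the line (to the right for `d = true`, to the left for `d = false`) and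
toggles the lamp sitting on that edge if `b = true`. The lamp of the edge from `x - 1` to `x` has
coordinate `x`. -/
structure EdgeLamps {G : Type*} [Group G] (S : Set G) where
  s : Bool → Bool → Letters S
  s_surj : ∀ x, ∃ d b, x = s d b
  s_mul_inv : ∀ d b, (s d b).1 * (s (!d) b).1 = 1
  c : G → ℤ
  f : G → ℤ → ZMod 2
  coords_ext : ∀ g h, c g = c h → (∀ x, f g x = f h x) → g = h
  c_mul : ∀ g h, c (g * h) = c g + c h
  f_mul : ∀ g h x, f (g * h) x = f g x + f h (x - c g)
  c_right : ∀ b, c (s true b).1 = 1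
  c_left : ∀ b, c (s false b).1 = -1
  f_right : ∀ b x, f (s true b).1 x = if b = true ∧ x = 1 then 1 else 0
  f_left : ∀ b x, f (s false b).1 x = if b = true ∧ x = 0 then 1 else 0

namespace EdgeLamps

variable {G : Type*} [Group G] {S : Set G} (E : EdgeLamps S)

theorem c_one : E.c 1 = 0 := by
  have := E.c_mul 1 1
  rw [mul_one] at this
  omega

theorem f_one (x : ℤ) : E.f 1 x = 0 := by
  have := E.f_mul 1 1 x
  rw [mul_one, E.c_one, sub_zero] at this
  simpa using this

/-- The mirror image of a coordinate system. -/
def swap : EdgeLamps S where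
  s d := E.s (!d)
  s_surj x := by
    obtain ⟨d, b, h⟩ := E.s_surj x
    exact ⟨!d, b, by simpa using h⟩
  s_mul_inv d b := E.s_mul_inv _ _
  c g := -E.c g
  -- Reflection sends the edge from `x - 1` to `x` to the edge from `-x` to `1 - x`, whose label is
  -- `1 - x`.
  f g x := E.f g (1 - x)
  coords_ext g h hc hf := by
    refine E.coords_ext g h (by omega) fun x => ?_
    have := hf (1 - x)
    simpa using this
  c_mul g h := by rw [E.c_mul]; ring
  f_mul g h x := by rw [E.f_mul]; congr 2; ring
  c_right b := by simp [E.c_left]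
  c_left b := by simp [E.c_right]
  f_right b x := by
    simp only [Bool.not_true, E.f_left]
    congr 1
    simp only [eq_iff_iff, and_congr_right_iff]
    intro; constructor <;> intro <;> omega
  f_left b x := by
    simp only [Bool.not_false, E.f_right]
    congr 1
    simp only [eq_iff_iff, and_congr_right_iff]
    intro; constructor <;> intro <;> omega

/-- All lit lamps of `g` lie on edges between `m` and `M`. -/
def InRange (g : G) (m M : ℤ) : Prop := ∀ x, E.f g x ≠ 0 → m < x ∧ x ≤ M

variable {E}

theorem InRange.eq_zero {g : G} {m M : ℤ} (h : E.InRange g m M) {x : ℤ} (hx : x ≤ m ∨ M < x) :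
    E.f g x = 0 := by
  by_contra hne
  have := h x hne
  omega

theorem InRange.mono {g : G} {m M m' M' : ℤ} (h : E.InRange g m M) (hm : m' ≤ m) (hM : M ≤ M') :
    E.InRange g m' M' := fun x hx => by
  have := h x hx
  omega

theorem InRange.mul {g h : G} {m M : ℤ} (hg : E.InRange g m M)
    (hh : E.InRange h (m - E.c g) (M - E.c g)) : E.InRange (g * h) m M := by
  intro x hx
  by_contra hne
  rw [E.f_mul, hg.eq_zero (by omega), hh.eq_zero (by omega), add_zero] at hx
  exact hx rfl

theorem InRange.swap {g : G} {m M : ℤ} (h : E.InRange g m M) : E.swap.InRange g (-M) (-m) := by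
  intro x hx
  have := h (1 - x) hx
  omega

variable (E)

theorem inRange_one : E.InRange 1 0 0 := fun x hx => absurd (E.f_one x) hx

theorem inRange_right (b : Bool) : E.InRange (E.s true b).1 0 1 := by
  intro x hx
  rw [E.f_right] at hx
  by_cases h : b = true ∧ x = 1
  · omega
  · simp [h] at hx

theorem inRange_left (b : Bool) : E.InRange (E.s false b).1 (-1) 0 := by
  intro x hx
  rw [E.f_left] at hx
  by_cases h : b = true ∧ x = 0
  · omega
  · simp [h] at hx

/-- The value of the word all of whose letters point in the direction `d`. -/
def run (d : Bool) (α : List Bool) : G := wordValue (α.map (E.s d))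

theorem run_append (d : Bool) (α β : List Bool) : E.run d (α ++ β) = E.run d α * E.run d β := by
  simp [run, wordValue_append]

theorem run_cons (d b : Bool) (α : List Bool) :
    E.run d (b :: α) = E.run d [b] * E.run d α := E.run_append d [b] α

theorem run_nil (d : Bool) : E.run d [] = 1 := rfl

theorem run_singleton (d b : Bool) : E.run d [b] = (E.s d b).1 := by
  simp [run, wordValue]

theorem swap_run (d : Bool) (α : List Bool) : E.swap.run d α = E.run (!d) α := rfl

theorem c_run_right (α : List Bool) : E.c (E.run true α) = α.length := by
  induction α using List.reverseRecOn with
  | nil => simp [run_nil, c_one]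
  | append_singleton α b ih => simp [run_append, c_mul, ih, run_singleton, c_right]

theorem c_run_left (α : List Bool) : E.c (E.run false α) = -α.length := by
  have := E.swap.c_run_right α
  rw [swap_run] at this
  change -E.c (E.run false α) = _ at this
  omega

theorem inRange_run_right (α : List Bool) : E.InRange (E.run true α) 0 α.length := by
  induction α using List.reverseRecOn with
  | nil => simpa [run_nil] using E.inRange_one
  | append_singleton α b ih =>
    rw [run_append, run_singleton]
    refine (ih.mono le_rfl (by simp)).mul ((E.inRange_right b).mono ?_ ?_) <;>
      simp [c_run_right]

theorem inRange_run_left (α : List Bool) : E.InRange (E.run false α) (-α.length) 0 := by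
  have := (E.swap.inRange_run_right α).swap
  intro x hx
  refine this x ?_ |>.imp id (by simp)
  change E.f (E.run false α) (1 - (1 - x)) ≠ 0
  simpa using hx

theorem run_replicate_false (d : Bool) (n : ℕ) (x : ℤ) :
    E.f (E.run d (List.replicate n false)) x = 0 := by
  induction n generalizing x with
  | zero => simp [run_nil, f_one]
  | succ n ih =>
    rw [List.replicate_succ', run_append, run_singleton, f_mul, ih]
    cases d <;> simp [f_right, f_left]

/-- Every configuration of lamps on the `n` edges to the right of the origin is written by
a sweep across these edges. -/
theorem exists_run_eq (n : ℕ) (φ : ℤ → ZMod 2) (hφ : ∀ x, φ x ≠ 0 → 0 < x ∧ x ≤ n) :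
    ∃ α : List Bool, α.length = n ∧ ∀ x, E.f (E.run true α) x = φ x := by
  induction n generalizing φ with
  | zero =>
    refine ⟨[], rfl, fun x => ?_⟩
    rw [run_nil, f_one]
    by_contra h
    have := hφ x (Ne.symm h)
    simp at this
    omega
  | succ n ih =>
    obtain ⟨α, hα, h⟩ := ih (Function.update φ (n + 1) 0) (by
      intro x hx
      by_cases hxn : x = n + 1
      · subst hxn; simp at hx
      · rw [Function.update_of_ne hxn] at hx
        have := hφ x hx
        push_cast at this
        omega)
    refine ⟨α ++ [decide (φ (n + 1) ≠ 0)], by simp [hα], fun x => ?_⟩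
    rw [run_append, run_singleton, f_mul, h, c_run_right, hα, f_right]
    by_cases hxn : x = n + 1
    · subst hxn
      have h2 : ∀ z : ZMod 2, z = 0 ∨ z = 1 := by decide
      rcases h2 (φ (n + 1)) with h0 | h0 <;> simp [h0]
    · rw [Function.update_of_ne hxn, if_neg (by omega), add_zero]

/-- Walk left to `m` without toggling, sweep right to `M` writing all lamps, and walk back to the
cursor: `-m + (M - m) + (M - c)` letters. -/
theorem exists_word_of_nonneg {g : G} {m M : ℤ} (hm : m ≤ 0) (hM : 0 ≤ M)
    (hcM : E.c g ≤ M) (hg : E.InRange g m M) :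
    ∃ v : List (Letters S), wordValue v = g ∧ (v.length : ℤ) = 2 * (M - m) - E.c g := by
  obtain ⟨i, hi⟩ := Int.eq_ofNat_of_zero_le (a := -m) (by omega)
  obtain ⟨j, hj⟩ := Int.eq_ofNat_of_zero_le (a := M - m) (by omega)
  obtain ⟨k, hk⟩ := Int.eq_ofNat_of_zero_le (a := M - E.c g) (by omega)
  obtain ⟨α, hα, h⟩ := E.exists_run_eq j (fun x => E.f g (x + m)) (by
    intro x hx
    have := hg _ hx
    omega)
  refine ⟨(List.replicate i false).map (E.s false) ++ (α.map (E.s true) ++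
    (List.replicate k false).map (E.s false)), ?_, ?_⟩
  · rw [wordValue_append, wordValue_append]
    change E.run false _ * (E.run true _ * E.run false _) = g
    refine E.coords_ext _ _ ?_ fun x => ?_
    · simp only [c_mul, c_run_left, c_run_right, List.length_replicate, hα]
      omega
    · simp only [f_mul, run_replicate_false, h, c_run_left, List.length_replicate]
      rw [zero_add, add_zero]
      congr 1
      omega
  · simp only [List.length_append, List.length_map, List.length_replicate, hα]
    push_cast
    omega

theorem exists_word {g : G} {m M : ℤ} (hm : m ≤ 0) (hM : 0 ≤ M) (hmc : m ≤ E.c g)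
    (hcM : E.c g ≤ M) (hg : E.InRange g m M) :
    ∃ v : List (Letters S), wordValue v = g ∧ (v.length : ℤ) = 2 * (M - m) - |E.c g| := by
  rcases le_total 0 (E.c g) with h | h
  · rw [abs_of_nonneg h]
    exact E.exists_word_of_nonneg hm hM hcM hg
  · have hs : E.swap.c g = -E.c g := rfl
    obtain ⟨v, hv, hl⟩ := E.swap.exists_word_of_nonneg (g := g) (m := -M) (M := -m) (by omega)
      (by omega) (by omega) hg.swap
    refine ⟨v, hv, ?_⟩
    rw [abs_of_nonpos h]
    omega

variable {E} in
theorem length_le_of_geodesic {w : List (Letters S)} (hw : IsGeodesicWord w) {m M : ℤ}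
    (hm : m ≤ 0) (hM : 0 ≤ M) (hmc : m ≤ E.c (wordValue w)) (hcM : E.c (wordValue w) ≤ M)
    (hr : E.InRange (wordValue w) m M) :
    (w.length : ℤ) ≤ 2 * (M - m) - |E.c (wordValue w)| := by
  obtain ⟨v, hv, hl⟩ := E.exists_word hm hM hmc hcM hr
  rw [← hl]
  exact_mod_cast hw v hv

/-- Lower bound for lengths: one letter raises `2 * (M - m) - |c|` by at most one. Inside the
interval only `|c|` moves; when an end is pushed out, the cursor was at that end, so `|c|` grows too
and the increase is `2 - 1`. -/
theorem exists_range (v : List (Letters S)) :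
    ∃ m M : ℤ, m ≤ 0 ∧ 0 ≤ M ∧ m ≤ E.c (wordValue v) ∧ E.c (wordValue v) ≤ M ∧
      E.InRange (wordValue v) m M ∧ 2 * (M - m) - |E.c (wordValue v)| ≤ v.length := by
  induction v using List.reverseRecOn with
  | nil => exact ⟨0, 0, by simp [wordValue_nil, c_one, E.inRange_one]⟩
  | append_singleton v x ih =>
    obtain ⟨m, M, hm, hM, hmc, hcM, hr, hl⟩ := ih
    obtain ⟨d, b, rfl⟩ := E.s_surj x
    rw [wordValue_append, wordValue_singleton]
    simp only [List.length_append, List.length_singleton]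
    push_cast
    cases d
    · refine ⟨min m (E.c (wordValue v) - 1), M, by omega, hM, ?_, ?_,
        (hr.mono (by omega) le_rfl).mul ((E.inRange_left b).mono (by omega) (by omega)), ?_⟩ <;>
      rw [c_mul, c_left]
      · omega
      · omega
      · rcases abs_cases (E.c (wordValue v)) with h1 | h1 <;>
        rcases abs_cases (E.c (wordValue v) + -1) with h2 | h2 <;> omega
    · refine ⟨m, max M (E.c (wordValue v) + 1), hm, by omega, ?_, ?_,
        (hr.mono le_rfl (by omega)).mul ((E.inRange_right b).mono (by omega) (by omega)), ?_⟩ <;>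
      rw [c_mul, c_right]
      · omega
      · omega
      · rcases abs_cases (E.c (wordValue v)) with h1 | h1 <;>
        rcases abs_cases (E.c (wordValue v) + 1) with h2 | h2 <;> omega

end EdgeLamps

/-! ### Tours and their turning letters -/

section Tours

variable {T : Type*} (s : Bool → Bool → T) (d : Bool)

/-- The initial excursion of a tour in the direction `d`, closed by a turn whose two letters toggle
the lamp at the turning point once; `Climb s d n u` says that `u` is such an excursion with `n`
letters before the turn, or empty. -/
inductive Climb : ℕ → List T → Prop
  | nil : Climb 0 []
  | turn (α : List Bool) (b : Bool) : Climb α.length (α.map (s d) ++ [s d b, s (!d) (!b)])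

/-- The final excursion of a tour, in the direction `d`, opened by a turn. -/
inductive Descent : ℕ → List T → Prop
  | nil : Descent 0 []
  | turn (b : Bool) (γ : List Bool) : Descent γ.length (s (!d) b :: s d (!b) :: γ.map (s d))

/-- Words that walk in the direction `d`, then in the other direction at least as far as the two
excursions together, then in the direction `d` again, turning properly. -/
def IsTour (w : List T) : Prop :=
  ∃ (n k : ℕ) (u v : List T) (β : List Bool), Climb s d n u ∧ Descent s d k v ∧
    n + k ≤ β.length ∧ w = u ++ (β.map (s !d) ++ v)

/-- Words with the shape of a tour, regardless of the letters at the turning points. -/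
def HasTourShape (w : List T) : Prop :=
  ∃ α β γ : List Bool, α.length + γ.length ≤ β.length ∧
    w = α.map (s d) ++ (β.map (s !d) ++ γ.map (s d))

end Tours

/-- Equal toggling bits at a turn would give two cancelling letters, so geodesicity forces opposite
bits. Each turn takes one letter from the middle leg and one from an outer leg, which preserves the
inequality between lengths. -/
theorem HasTourShape.isTour {G : Type*} [Group G] {S : Set G} {s : Bool → Bool → Letters S}
    (hs : ∀ d b, (s d b).1 * (s (!d) b).1 = 1) {d : Bool} {w : List (Letters S)}
    (hw : IsGeodesicWord w) (h : HasTourShape s d w) : IsTour s d w := by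
  obtain ⟨α, β, γ, hl, rfl⟩ := h
  have hu : ∃ (n : ℕ) (u : List (Letters S)) (β' : List Bool), Climb s d n u ∧
      n + γ.length ≤ β'.length ∧ α.map (s d) ++ β.map (s !d) = u ++ β'.map (s !d) := by
    rcases List.eq_nil_or_concat α with rfl | ⟨α', x, rfl⟩
    · exact ⟨0, [], β, .nil, by simpa using hl, rfl⟩
    · rcases β with _ | ⟨y, β⟩
      · simp at hl
      · have hxy : y = !x := by
          by_contra hne
          have hyx : y = x := by cases x <;> cases y <;> simp_all
          subst hyx
          refine IsGeodesicWord.not_cancel (u := α'.map (s d)) (x := s d y) (y := s (!d) y)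
            (v := β.map (s !d) ++ γ.map (s d)) ?_ (hs d y)
          simpa using hw
        subst hxy
        refine ⟨_, _, β, .turn α' x, ?_, by simp⟩
        simp at hl
        omega
  obtain ⟨n, u, β', hu, hl', he⟩ := hu
  rw [← List.append_assoc, he] at hw ⊢
  rcases γ with _ | ⟨z, γ⟩
  · exact ⟨n, 0, u, [], β', hu, .nil, by simpa using hl', by simp⟩
  · rcases List.eq_nil_or_concat β' with rfl | ⟨β, y, rfl⟩
    · simp at hl'
    · have hyz : z = !y := by
        by_contra hne
        have hyx : z = y := by cases z <;> cases y <;> simp_all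
        subst hyx
        refine IsGeodesicWord.not_cancel (u := u ++ β.map (s !d)) (x := s (!d) z) (y := s d z)
            (v := γ.map (s d)) ?_ (by simpa using hs (!d) z)
        simpa using hw
      subst hyz
      refine ⟨n, _, u, _, β, hu, .turn y γ, ?_, by simp⟩
      simp at hl'
      omega

/-! ### Geodesics are exactly the tours -/

namespace EdgeLamps

variable {G : Type*} [Group G] {S : Set G} (E : EdgeLamps S)

theorem wordValue_tourShape (d : Bool) (α β γ : List Bool) :
    wordValue (α.map (E.s d) ++ (β.map (E.s !d) ++ γ.map (E.s d))) =
      E.run d α * (E.run (!d) β * E.run d γ) := by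
  rw [wordValue_append, wordValue_append]
  rfl

theorem c_tourShape (α β γ : List Bool) :
    E.c (E.run true α * (E.run false β * E.run true γ)) =
      α.length - β.length + γ.length := by
  simp only [c_mul, c_run_right, c_run_left]
  ring

theorem inRange_tourShape {α β γ : List Bool} (h : α.length + γ.length ≤ β.length) :
    E.InRange (E.run true α * (E.run false β * E.run true γ)) (α.length - β.length) α.length := by
  refine ((E.inRange_run_right α).mono (by omega) le_rfl).mul
    (((E.inRange_run_left β).mono ?_ ?_).mul ((E.inRange_run_right γ).mono ?_ ?_)) <;>
    simp only [c_run_right, c_run_left] <;> omega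

/-- A letter that spoils the shape keeps the cursor in the interval but takes it away from the
origin, so the cost drops by one while the word grows by one. The exception is a two-leg word back
at the origin: its continuation is a tour in the other direction. -/
theorem hasTourShape_concat {w : List (Letters S)} {x : Letters S}
    (h : HasTourShape E.s true w) (hw : IsGeodesicWord (w ++ [x])) :
    HasTourShape E.s true (w ++ [x]) ∨ HasTourShape E.s false (w ++ [x]) := by
  obtain ⟨α, β, γ, hl, rfl⟩ := h
  have hc := E.c_tourShape α β γ
  have hr := E.inRange_tourShape hl
  have hbound := fun h1 h2 h3 => E.length_le_of_geodesic hw (m := α.length - β.length)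
    (M := α.length) (by omega) (by omega) h1 h2 h3
  obtain ⟨d, b, rfl⟩ := E.s_surj x
  rw [wordValue_append, wordValue_singleton, E.wordValue_tourShape] at hbound
  simp only [Bool.not_true] at hbound
  rw [c_mul, hc] at hbound
  simp only [List.length_append, List.length_map, List.length_singleton] at hbound
  cases d
  · rw [c_left] at hbound
    rcases γ with _ | ⟨z, γ⟩
    · refine Or.inl ⟨α, β ++ [b], [], ?_, by simp⟩
      simp at hl ⊢
      omega
    · exfalso
      simp only [List.length_cons] at *
      have := hbound (by omega) (by omega)
        (hr.mul ((E.inRange_left b).mono (by omega) (by omega)))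
      rw [abs_of_nonpos (by omega)] at this
      omega
  · rw [c_right] at hbound
    by_cases hlt : α.length + γ.length < β.length
    · exact Or.inl ⟨α, β, γ ++ [b], by simp; omega, by simp⟩
    · rcases α with _ | ⟨z, α⟩
      -- Here the cursor is at the origin and there is no first leg, so the old middle leg becomes
      -- the first leg of the mirrored shape.
      · exact Or.inr ⟨β, γ ++ [b], [], by simp at *; omega, by simp⟩
      · exfalso
        simp only [List.length_cons] at *
        have := hbound (by omega) (by omega)
          (hr.mul ((E.inRange_right b).mono (by omega) (by omega)))
        rw [abs_of_nonneg (by omega)] at this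
        omega

theorem hasTourShape_of_geodesic {w : List (Letters S)} (hw : IsGeodesicWord w) :
    ∃ d, HasTourShape E.s d w := by
  induction w using List.reverseRecOn with
  | nil => exact ⟨true, [], [], [], by simp, rfl⟩
  | append_singleton w x ih =>
    obtain ⟨d, hd⟩ := ih hw.of_append_left
    cases d
    · rcases E.swap.hasTourShape_concat hd hw with h | h
      · exact ⟨false, h⟩
      · exact ⟨true, h⟩
    · rcases E.hasTourShape_concat hd hw with h | h
      · exact ⟨true, h⟩
      · exact ⟨false, h⟩

theorem f_turn_right (b : Bool) (x : ℤ) :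
    E.f (E.run true [b] * E.run false [!b]) x = if x = 1 then 1 else 0 := by
  rw [run_singleton, run_singleton, f_mul, c_right, f_right, f_left]
  have : x - 1 = 0 ↔ x = 1 := by omega
  cases b <;> simp [this]

theorem f_turn_left (b : Bool) (x : ℤ) :
    E.f (E.run false [b] * E.run true [!b]) x = if x = 0 then 1 else 0 := by
  rw [run_singleton, run_singleton, f_mul, c_left, f_right, f_left]
  cases b <;> simp

/-- The lamp at the turning point of the initial excursion of a tour is lit. -/
theorem f_climb (α β γ : List Bool) (b : Bool) (h : γ.length ≤ β.length) :
    E.f (E.run true (α ++ [b]) * (E.run false ((!b) :: β) * E.run true γ)) (α.length + 1) = 1 := by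
  have hg : E.run true (α ++ [b]) * (E.run false ((!b) :: β) * E.run true γ) =
      E.run true α * ((E.run true [b] * E.run false [!b]) * (E.run false β * E.run true γ)) := by
    rw [run_append, E.run_cons false]
    simp only [mul_assoc]
  have ht : E.c (E.run true [b] * E.run false [!b]) = 0 := by
    rw [c_mul, c_run_left, c_run_right]; simp
  have hr : E.InRange (E.run false β * E.run true γ) (-β.length) 0 :=
    (E.inRange_run_left β).mul ((E.inRange_run_right γ).mono (by rw [c_run_left]; omega)
      (by rw [c_run_left]; omega))
  rw [hg, f_mul, f_mul, (E.inRange_run_right α).eq_zero (by omega), c_run_right, f_turn_right,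
    hr.eq_zero (by omega)]
  simp

/-- The lamp at the turning point of the final excursion of a tour is lit. -/
theorem f_descent (α β γ : List Bool) (b : Bool) (h : α.length ≤ β.length) :
    E.f (E.run true α * (E.run false (β ++ [b]) * E.run true ((!b) :: γ)))
      (α.length - β.length) = 1 := by
  have hg : E.run true α * (E.run false (β ++ [b]) * E.run true ((!b) :: γ)) =
      (E.run true α * E.run false β) * ((E.run false [b] * E.run true [!b]) * E.run true γ) := by
    rw [run_append, E.run_cons true]
    simp only [mul_assoc]
  have ht : E.c (E.run false [b] * E.run true [!b]) = 0 := by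
    rw [c_mul, c_run_left, c_run_right]; simp
  have hr : E.InRange (E.run true α * E.run false β) (α.length - β.length) α.length :=
    ((E.inRange_run_right α).mono (by omega) le_rfl).mul ((E.inRange_run_left β).mono
      (by rw [c_run_right]; omega) (by rw [c_run_right]; omega))
  rw [hg, f_mul, f_mul _ (_ * _) (E.run true γ), hr.eq_zero (by omega), c_mul, c_run_right,
    c_run_left, ht, f_turn_left, (E.inRange_run_right γ).eq_zero (by omega)]
  simp [sub_eq_add_neg]

/-- The lit turning edges, or the endpoints of the walk where an excursion is missing, force the
interval of any competing word to contain that of the tour. The lower bound of `exists_range` is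
then the length of the tour. -/
theorem isGeodesicWord_of_isTour_true {w : List (Letters S)} (h : IsTour E.s true w) :
    IsGeodesicWord w := by
  obtain ⟨n, k, u, v, β, hu, hv, hl, rfl⟩ := h
  obtain ⟨α, γ, β', he, hle, hf1, hf2⟩ : ∃ α γ β' : List Bool,
      u ++ (β.map (E.s !true) ++ v) = α.map (E.s true) ++ (β'.map (E.s !true) ++ γ.map (E.s true)) ∧
      α.length + γ.length ≤ β'.length ∧
      (α ≠ [] → E.f (E.run true α * (E.run false β' * E.run true γ)) α.length = 1) ∧
      (γ ≠ [] → E.f (E.run true α * (E.run false β' * E.run true γ))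
        (α.length - β'.length + 1) = 1) := by
    rcases hu with _ | ⟨α, b⟩ <;> rcases hv with _ | ⟨b', γ⟩
    · exact ⟨[], [], β, by simp, by simp, by simp, by simp⟩
    · refine ⟨[], (!b') :: γ, β ++ [b'], by simp, by simp at *; omega, by simp, fun _ => ?_⟩
      convert E.f_descent [] β γ b' (by simp) using 2
      simp
    · refine ⟨α ++ [b], [], (!b) :: β, by simp, by simp at *; omega, fun _ => ?_, by simp⟩
      simpa using E.f_climb α β [] b (by simp)
    · refine ⟨α ++ [b], (!b') :: γ, (!b) :: β ++ [b'], by simp, by simp at *; omega,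
        fun _ => ?_, fun _ => ?_⟩
      · simpa using E.f_climb α (β ++ [b']) ((!b') :: γ) b (by simp; omega)
      · convert E.f_descent (α ++ [b]) ((!b) :: β) γ b' (by simp; omega) using 2
        simp
        ring
  rw [he]
  intro v' hv'
  obtain ⟨m, M, hm, hM, hmc, hcM, hr, hlen⟩ := E.exists_range v'
  rw [hv', E.wordValue_tourShape] at hmc hcM hr hlen
  simp only [Bool.not_true] at hmc hcM hr hlen
  rw [c_tourShape] at hmc hcM hlen
  rw [abs_of_nonpos (by omega)] at hlen
  have h1 : (α.length : ℤ) ≤ M := by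
    rcases eq_or_ne α [] with rfl | hα
    · simpa using hM
    · exact (hr _ (by rw [hf1 hα]; decide)).2
  have h2 : m ≤ α.length - β'.length := by
    rcases eq_or_ne γ [] with rfl | hγ
    · simpa using hmc
    · have := (hr _ (by rw [hf2 hγ]; decide)).1
      omega
  simp only [List.length_append, List.length_map]
  omega

theorem isGeodesicWord_iff (w : List (Letters S)) : IsGeodesicWord w ↔ ∃ d, IsTour E.s d w := by
  constructor
  · intro h
    obtain ⟨d, hd⟩ := E.hasTourShape_of_geodesic h
    exact ⟨d, hd.isTour E.s_mul_inv h⟩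
  · rintro ⟨d, h⟩
    cases d
    · refine E.swap.isGeodesicWord_of_isTour_true ?_
      obtain ⟨n, k, u, v, β, hu, hv, hl, rfl⟩ := h
      refine ⟨n, k, u, v, β, ?_, ?_, hl, rfl⟩
      · rcases hu with _ | ⟨α, b⟩
        · exact .nil
        · exact .turn α b
      · rcases hv with _ | ⟨b, γ⟩
        · exact .nil
        · exact .turn b γ
    · exact E.isGeodesicWord_of_isTour_true h

end EdgeLamps

/-! ### A one-counter automaton for tours -/

section CounterAutomaton

/-- The element of `ℤ^1` with coordinate `n`. -/
def counterLabel (n : ℤ) : Multiplicative (Fin 1 → ℤ) := Multiplicative.ofAdd fun _ => n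

theorem counterLabel_zero : counterLabel 0 = 1 := rfl

/-- The vertices of an automaton reading a tour. -/
inductive TourPhase
  | climb
  | up (b : Bool)
  | mid
  | down (b : Bool)
  | fall

instance : Finite TourPhase := by
  refine Finite.of_surjective (fun x : Option (Option (Option (Bool × Bool))) => match x with
    | none => TourPhase.climb
    | some none => .mid
    | some (some none) => .fall
    | some (some (some (true, b))) => .up b
    | some (some (some (false, b))) => .down b) fun y => ?_
  cases y with
  | climb => exact ⟨none, rfl⟩
  | mid => exact ⟨some none, rfl⟩
  | fall => exact ⟨some (some none), rfl⟩
  | up b => exact ⟨some (some (some (true, b))), rfl⟩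
  | down b => exact ⟨some (some (some (false, b))), rfl⟩

variable {T : Type*} (s : Bool → Bool → T)

open TourPhase in
/-- The transitions between the phases of a tour, with weights. -/
inductive TourStep (d : Bool) : TourPhase → T → ℤ → TourPhase → Prop
  | climb (b : Bool) : TourStep d climb (s d b) (-1) climb
  | climb_up (b : Bool) : TourStep d climb (s d b) 0 (up b)
  | up_mid (b : Bool) : TourStep d (up b) (s (!d) (!b)) 0 mid
  | mid (b c : Bool) : TourStep d mid (s (!d) b) (if c then 1 else 0) mid
  | mid_down (b : Bool) : TourStep d mid (s (!d) b) 0 (down b)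
  | down_fall (b : Bool) : TourStep d (down b) (s d (!b)) 0 fall
  | fall (b : Bool) : TourStep d fall (s d b) (-1) fall

/-- The edges of the automaton accepting tours: those that choose the first phase, and those that
read a letter. -/
inductive TourEdge : Option (Bool × TourPhase) × Option T × Multiplicative (Fin 1 → ℤ) ×
    Option (Bool × TourPhase) → Prop
  | start (d c : Bool) : TourEdge
      (none, none, counterLabel 0, some (d, if c then TourPhase.climb else TourPhase.mid))
  | step {d : Bool} {p q : TourPhase} {x : T} {n : ℤ} : TourStep s d p x n q →
      TourEdge (some (d, p), some x, counterLabel n, some (d, q))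

theorem finite_tourEdge : {e | TourEdge s e}.Finite := by
  refine ((Set.toFinite (Set.univ : Set (Option (Bool × TourPhase)))).prod
    (((Set.finite_range fun y : Bool × Bool => some (s y.1 y.2)).insert none).prod
    (((Set.toFinite ({0, 1, -1} : Set ℤ)).image counterLabel).prod
    (Set.toFinite (Set.univ : Set (Option (Bool × TourPhase))))))).subset ?_
  rintro _ (⟨d, c⟩ | @⟨d, p, q, x, n, h⟩)
  · simp
  · refine ⟨Set.mem_univ _, Or.inr ?_, Set.mem_image_of_mem _ ?_, Set.mem_univ _⟩
    · cases h <;> exact ⟨(_, _), rfl⟩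
    · cases h <;> simp
      split_ifs <;> simp

/-- A `ℤ`-automaton accepting tours. -/
def tourAutomaton : GroupAutomaton (Multiplicative (Fin 1 → ℤ)) T where
  State := Option (Bool × TourPhase)
  finite_state := inferInstance
  edges := {e | TourEdge s e}
  finite_edges := finite_tourEdge s
  start := none
  accept := {q | ∃ d, q = some (d, .mid) ∨ q = some (d, .fall)}

/-- The words and weights that can be read from the phase `mid` to acceptance. -/
def ReadsMid (d : Bool) (w : List T) (z : ℤ) : Prop :=
  ∃ (β : List Bool) (k : ℕ) (v : List T), Descent s d k v ∧
    w = β.map (s !d) ++ v ∧ -k ≤ z ∧ z ≤ β.length - k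

/-- The words and weights that can be read from a given phase to acceptance. -/
def TourPhase.Reads (d : Bool) : TourPhase → List T → ℤ → Prop
  | .fall, w, z => ∃ γ : List Bool, w = γ.map (s d) ∧ z = -γ.length
  | .down b, w, z => ∃ γ : List Bool, w = s d (!b) :: γ.map (s d) ∧ z = -γ.length
  | .mid, w, z => ReadsMid s d w z
  | .up b, w, z => ∃ w', w = s (!d) (!b) :: w' ∧ ReadsMid s d w' z
  | .climb, w, z => ∃ (α : List Bool) (b : Bool) (w' : List T),
      w = α.map (s d) ++ (s d b :: s (!d) (!b) :: w') ∧ ReadsMid s d w' (z + α.length)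

variable {s}

theorem TourStep.reads {d : Bool} {p q : TourPhase} {x : T} {n z : ℤ} {w : List T}
    (h : TourStep s d p x n q) (hq : q.Reads s d w z) : p.Reads s d (x :: w) (n + z) := by
  cases h with
  | climb b =>
    obtain ⟨α, b', w', rfl, h⟩ := hq
    refine ⟨b :: α, b', w', rfl, ?_⟩
    convert h using 1
    simp
    ring
  | climb_up b =>
    obtain ⟨w', rfl, h⟩ := hq
    exact ⟨[], b, w', rfl, by simpa using h⟩
  | up_mid b => exact ⟨w, rfl, by rw [zero_add]; exact hq⟩
  | mid b c =>
    obtain ⟨β, k, v, hv, rfl, h1, h2⟩ := hq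
    refine ⟨b :: β, k, v, hv, rfl, ?_, ?_⟩ <;> cases c <;> simp <;> omega
  | mid_down b =>
    obtain ⟨γ, rfl, h⟩ := hq
    exact ⟨[], _, _, .turn b γ, rfl, by simp [h], by simp [h]⟩
  | down_fall b =>
    obtain ⟨γ, rfl, h⟩ := hq
    exact ⟨γ, rfl, by simp [h]⟩
  | fall b =>
    obtain ⟨γ, rfl, h⟩ := hq
    exact ⟨b :: γ, rfl, by simp [h]⟩

theorem TourPhase.Reads.isTour_mid {d : Bool} {w : List T} (h : TourPhase.mid.Reads s d w 0) :
    IsTour s d w := by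
  obtain ⟨β, k, v, hv, rfl, h1, h2⟩ := h
  exact ⟨0, k, [], v, β, .nil, hv, by omega, rfl⟩

theorem TourPhase.Reads.isTour_climb {d : Bool} {w : List T}
    (h : TourPhase.climb.Reads s d w 0) : IsTour s d w := by
  obtain ⟨α, b, w, rfl, β, k, v, hv, rfl, h1, h2⟩ := h
  exact ⟨_, k, _, v, β, .turn α b, hv, by omega, by simp⟩

/-- Soundness, with `Reads` as invariant, by induction from the accepting end of the path. The start
vertex belongs to no phase and has a clause of its own. -/
theorem tourAutomaton_reads {q r : (tourAutomaton s).State} {w : List T}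
    {g : Multiplicative (Fin 1 → ℤ)} (h : (tourAutomaton s).Path q w g r)
    (hr : r ∈ (tourAutomaton s).accept) :
    (∀ d p, q = some (d, p) → p.Reads s d w (g.toAdd 0)) ∧
      (q = none → g = 1 → ∃ d, IsTour s d w) := by
  induction h with
  | nil q =>
    obtain ⟨d, rfl | rfl⟩ := hr
    · refine ⟨?_, by simp⟩
      rintro _ _ ⟨⟩
      exact ⟨[], 0, [], .nil, rfl, by simp, by simp⟩
    · refine ⟨?_, by simp⟩
      rintro _ _ ⟨⟩
      exact ⟨[], rfl, by simp⟩
  | cons he hp ih =>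
    specialize ih hr
    cases he with
    | start d c =>
      refine ⟨by simp, fun _ hg => ⟨d, ?_⟩⟩
      rw [counterLabel_zero, one_mul] at hg
      have h := ih.1 _ _ rfl
      rw [hg] at h
      cases c
      · exact TourPhase.Reads.isTour_mid h
      · exact TourPhase.Reads.isTour_climb h
    | step hs =>
      refine ⟨?_, by simp⟩
      rintro _ _ ⟨⟩
      exact hs.reads (ih.1 _ _ rfl)

theorem tourAutomaton_path_start (d c : Bool) {w : List T} {g : Multiplicative (Fin 1 → ℤ)}
    {r : (tourAutomaton s).State} (h : (tourAutomaton s).Path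
      (some (d, if c then TourPhase.climb else TourPhase.mid)) w g r) :
    (tourAutomaton s).Path none w g r := by
  have he : (none, none, counterLabel 0, some (d, if c then TourPhase.climb else TourPhase.mid)) ∈
    (tourAutomaton s).edges := TourEdge.start d c
  simpa [counterLabel_zero] using GroupAutomaton.Path.cons he h

theorem TourStep.path {d : Bool} {p q : TourPhase} {x : T} {m n k : ℤ} {w : List T}
    {r : (tourAutomaton s).State} (h : TourStep s d p x m q)
    (hp : (tourAutomaton s).Path (some (d, q)) w (counterLabel n) r) (hk : k = m + n) :
    (tourAutomaton s).Path (some (d, p)) (x :: w) (counterLabel k) r := by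
  subst hk
  have he : (some (d, p), some x, counterLabel m, some (d, q)) ∈ (tourAutomaton s).edges :=
    TourEdge.step h
  exact GroupAutomaton.Path.cons he hp

theorem path_of_descent {d : Bool} {k : ℕ} {v : List T} (h : Descent s d k v) :
    ∃ r ∈ (tourAutomaton s).accept,
      (tourAutomaton s).Path (some (d, .mid)) v (counterLabel (-k)) r := by
  cases h with
  | nil => exact ⟨_, ⟨d, Or.inl rfl⟩, .nil _⟩
  | turn b γ =>
    refine ⟨some (d, .fall), ⟨d, Or.inr rfl⟩, (TourStep.mid_down b).path
      ((TourStep.down_fall b).path (n := -γ.length) ?_ (zero_add _).symm) (zero_add _).symm⟩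
    induction γ with
    | nil => exact .nil _
    | cons y γ ih => exact (TourStep.fall y).path ih (by simp)

/-- The loop at `mid` counts the first `n` letters of the leg and ignores the others; this freedom
turns an equality of counters into an inequality of lengths. -/
theorem path_mid {d : Bool} {β : List Bool} {n : ℕ} (hn : n ≤ β.length) {v : List T} {k : ℤ}
    {r : (tourAutomaton s).State}
    (h : (tourAutomaton s).Path (some (d, .mid)) v (counterLabel k) r) :
    (tourAutomaton s).Path (some (d, .mid)) (β.map (s !d) ++ v) (counterLabel (n + k)) r := by
  induction β generalizing n with
  | nil =>
    obtain rfl : n = 0 := by simpa using hn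
    simpa using h
  | cons b β ih =>
    cases n with
    | zero => exact (TourStep.mid b false).path (ih (Nat.zero_le _)) (by simp)
    | succ n =>
      exact (TourStep.mid b true).path (ih (Nat.le_of_succ_le_succ hn)) (by push_cast; simp; ring)

theorem path_climb {d : Bool} {n : ℕ} {u : List T} (hu : Climb s d n u) {v : List T} {k : ℤ}
    {r : (tourAutomaton s).State}
    (h : (tourAutomaton s).Path (some (d, .mid)) v (counterLabel k) r) :
    (tourAutomaton s).Path none (u ++ v) (counterLabel (-n + k)) r := by
  cases hu with
  | nil =>
    simpa using tourAutomaton_path_start d false h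
  | turn α b =>
    suffices (tourAutomaton s).Path (some (d, .climb))
        (α.map (s d) ++ [s d b, s (!d) (!b)] ++ v) (counterLabel (-α.length + k)) r from
      tourAutomaton_path_start d true this
    induction α with
    | nil =>
      exact (TourStep.climb_up b).path ((TourStep.up_mid b).path h (zero_add _).symm) (by simp)
    | cons a α ih => exact (TourStep.climb a).path ih (by simp; ring)

theorem tourAutomaton_language : (tourAutomaton s).language = {w | ∃ d, IsTour s d w} := by
  ext w
  constructor
  · rintro ⟨r, hr, hp⟩
    exact (tourAutomaton_reads hp hr).2 rfl rfl
  · rintro ⟨d, n, k, u, v, β, hu, hv, hl, rfl⟩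
    obtain ⟨r, hr, hp⟩ := path_of_descent hv
    refine ⟨r, hr, ?_⟩
    have h0 : -(n : ℤ) + ((n + k : ℕ) + -k) = 0 := by push_cast; ring
    have := path_climb hu (path_mid hl hp)
    rwa [h0, counterLabel_zero] at this

theorem isKCounter_isTour (s : Bool → Bool → T) :
    Language.IsKCounter 1 ({w | ∃ d, IsTour s d w} : Language T) :=
  ⟨tourAutomaton s, tourAutomaton_language⟩

end CounterAutomaton

/-! ### A context-free grammar for tours -/

section ContextFree

theorem ContextFreeGrammar.Derives.append {T : Type*} {g : ContextFreeGrammar T}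
    {u u' v v' : List (Symbol T g.NT)} (hu : g.Derives u u') (hv : g.Derives v v') :
    g.Derives (u ++ v) (u' ++ v') :=
  (hu.append_right v).trans (hv.append_left u')

/-- The words obtained from a sentential form by replacing every nonterminal by a word of the
language assigned to it. -/
inductive Fills {T N : Type*} (P : N → List T → Prop) : List (Symbol T N) → List T → Prop
  | nil : Fills P [] []
  | terminal (x : T) {u : List (Symbol T N)} {w : List T} : Fills P u w →
      Fills P (.terminal x :: u) (x :: w)
  | nonterminal (n : N) {u : List (Symbol T N)} {v w : List T} : P n v → Fills P u w →
      Fills P (.nonterminal n :: u) (v ++ w)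

namespace Fills

variable {T N : Type*} {P : N → List T → Prop}

theorem append_iff {u v : List (Symbol T N)} {w : List T} :
    Fills P (u ++ v) w ↔ ∃ w₁ w₂, Fills P u w₁ ∧ Fills P v w₂ ∧ w = w₁ ++ w₂ := by
  constructor
  · intro h
    induction u generalizing w with
    | nil => exact ⟨[], w, .nil, h, rfl⟩
    | cons x u ih =>
      cases h with
      | terminal x h =>
        obtain ⟨w₁, w₂, h1, h2, rfl⟩ := ih h
        exact ⟨_, w₂, .terminal x h1, h2, rfl⟩
      | nonterminal n hn h =>
        obtain ⟨w₁, w₂, h1, h2, rfl⟩ := ih h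
        exact ⟨_, w₂, .nonterminal n hn h1, h2, by simp⟩
  · rintro ⟨w₁, w₂, h1, h2, rfl⟩
    induction h1 with
    | nil => exact h2
    | terminal x _ ih => exact .terminal x ih
    | nonterminal n hn _ ih => rw [List.append_assoc]; exact .nonterminal n hn ih

theorem nonterminal_iff {n : N} {w : List T} : Fills P [.nonterminal n] w ↔ P n w := by
  constructor
  · rintro (_ | _ | ⟨_, h, ⟨⟩⟩)
    simpa using h
  · intro h
    simpa using Fills.nonterminal n h .nil

theorem map_terminal (w : List T) : Fills P (w.map .terminal) w := by
  induction w with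
  | nil => exact .nil
  | cons x w ih => exact .terminal x ih

end Fills

/-- Soundness of a context-free grammar with respect to an assignment of languages to its
nonterminals that is closed under the rules. -/
theorem ContextFreeGrammar.fills_of_derives {T : Type*} {g : ContextFreeGrammar T}
    {P : g.NT → List T → Prop}
    (hP : ∀ ρ ∈ g.rules, ∀ w, Fills P ρ.output w → P ρ.input w)
    {u : List (Symbol T g.NT)} {w : List T} (h : g.Derives u (w.map .terminal)) :
    Fills P u w := by
  induction h using Relation.ReflTransGen.head_induction_on with
  | refl => exact Fills.map_terminal w
  | head hstep _ ih =>
    obtain ⟨ρ, hρ, hrw⟩ := hstep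
    obtain ⟨p, q, rfl, rfl⟩ := hrw.exists_parts
    rw [List.append_assoc, Fills.append_iff] at ih ⊢
    obtain ⟨w₁, w', h1, h', rfl⟩ := ih
    rw [Fills.append_iff] at h'
    obtain ⟨w₂, w₃, h2, h3, rfl⟩ := h'
    exact ⟨w₁, w₂ ++ w₃, h1,
      Fills.append_iff.2 ⟨w₂, w₃, Fills.nonterminal_iff.2 (hP ρ hρ _ h2), h3, rfl⟩, rfl⟩

/-- The nonterminals of a grammar for tours: the initial one, one for possibly empty
excursions, one for nonempty excursions, and one for monotone words. -/
inductive TourNT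
  | tour
  | excursion (d : Bool)
  | hairpin (d : Bool)
  | ray (d : Bool)

variable {T : Type*} (s : Bool → Bool → T)

open TourNT Symbol in
/-- The rules of a grammar for tours. -/
inductive TourRule : ContextFreeRule T TourNT → Prop
  | tour (d : Bool) : TourRule ⟨tour,
      [nonterminal (excursion d), nonterminal (ray !d), nonterminal (excursion !d)]⟩
  | empty (d : Bool) : TourRule ⟨excursion d, []⟩
  | nonempty (d : Bool) : TourRule ⟨excursion d, [nonterminal (hairpin d)]⟩
  | turn (d b : Bool) : TourRule ⟨hairpin d, [terminal (s d b), terminal (s (!d) (!b))]⟩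
  | extend (d b c : Bool) : TourRule ⟨hairpin d,
      [terminal (s d b), nonterminal (hairpin d), terminal (s (!d) c)]⟩
  | halt (d : Bool) : TourRule ⟨ray d, []⟩
  | go (d b : Bool) : TourRule ⟨ray d, [terminal (s d b), nonterminal (ray d)]⟩

open TourNT Symbol in
theorem finite_tourRule : {ρ | TourRule s ρ}.Finite := by
  refine ((((((Set.finite_range fun d => (⟨tour, [nonterminal (excursion d),
    nonterminal (ray !d), nonterminal (excursion !d)]⟩ : ContextFreeRule T TourNT)).union
    (Set.finite_range fun d => ⟨excursion d, []⟩)).union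
    (Set.finite_range fun d => ⟨excursion d, [nonterminal (hairpin d)]⟩)).union
    (Set.finite_range fun y : Bool × Bool => ⟨hairpin y.1,
      [terminal (s y.1 y.2), terminal (s (!y.1) (!y.2))]⟩)).union
    (Set.finite_range fun y : Bool × Bool × Bool => ⟨hairpin y.1,
      [terminal (s y.1 y.2.1), nonterminal (hairpin y.1), terminal (s (!y.1) y.2.2)]⟩)).union
    ((Set.finite_range fun d => ⟨ray d, []⟩).union (Set.finite_range fun y : Bool × Bool =>
      ⟨ray y.1, [terminal (s y.1 y.2), nonterminal (ray y.1)]⟩))).subset ?_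
  rintro _ (d | d | d | ⟨d, b⟩ | ⟨d, b, c⟩ | d | ⟨d, b⟩)
  · exact .inl (.inl (.inl (.inl (.inl ⟨d, rfl⟩))))
  · exact .inl (.inl (.inl (.inl (.inr ⟨d, rfl⟩))))
  · exact .inl (.inl (.inl (.inr ⟨d, rfl⟩)))
  · exact .inl (.inl (.inr ⟨(d, b), rfl⟩))
  · exact .inl (.inr ⟨(d, b, c), rfl⟩)
  · exact .inr (.inl ⟨d, rfl⟩)
  · exact .inr (.inr ⟨(d, b), rfl⟩)

/-- A context-free grammar for tours. -/
noncomputable def tourGrammar : ContextFreeGrammar T where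
  NT := TourNT
  initial := .tour
  rules := (finite_tourRule s).toFinset

/-- A walk in the direction `d` and back, with a proper turn. -/
def IsHairpin (d : Bool) (w : List T) : Prop :=
  ∃ (α β : List Bool) (b : Bool), α.length = β.length ∧
    w = α.map (s d) ++ s d b :: s (!d) (!b) :: β.map (s !d)

/-- The words derivable from each nonterminal. -/
def TourNT.Generates : TourNT → List T → Prop
  | .tour, w => ∃ d, IsTour s d w
  | .excursion d, w => w = [] ∨ IsHairpin s d w
  | .hairpin d, w => IsHairpin s d w
  | .ray d, w => ∃ β : List Bool, w = β.map (s d)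

variable {s}

/-- The inner halves of the two hairpins and the ray between them merge into one middle leg, long
enough because hairpins are balanced. -/
theorem isTour_of_excursions {d : Bool} {u v : List T} (hu : u = [] ∨ IsHairpin s d u)
    (β : List Bool) (hv : v = [] ∨ IsHairpin s (!d) v) :
    IsTour s d (u ++ (β.map (s !d) ++ v)) := by
  obtain ⟨n, u', β₁, hu', hn, rfl⟩ : ∃ (n : ℕ) (u' : List T) (β₁ : List Bool),
      Climb s d n u' ∧ n = β₁.length ∧ u = u' ++ β₁.map (s !d) := by
    rcases hu with rfl | ⟨α, β₁, b, hl, rfl⟩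
    · exact ⟨0, [], [], .nil, rfl, rfl⟩
    · exact ⟨_, _, β₁, .turn α b, hl, by simp⟩
  obtain ⟨k, v', β₂, hv', hk, rfl⟩ : ∃ (k : ℕ) (v' : List T) (β₂ : List Bool),
      Descent s d k v' ∧ k = β₂.length ∧ v = β₂.map (s !d) ++ v' := by
    rcases hv with rfl | ⟨β₂, γ, b, hl, rfl⟩
    · exact ⟨0, [], [], .nil, rfl, rfl⟩
    · exact ⟨_, _, β₂, .turn b γ, hl.symm, by simp⟩
  exact ⟨n, k, u', v', β₁ ++ (β ++ β₂), hu', hv', by simp; omega, by simp⟩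

theorem tourRule_generates {ρ : ContextFreeRule T TourNT} (hρ : TourRule s ρ) {w : List T}
    (h : Fills (TourNT.Generates s) ρ.output w) : ρ.input.Generates s w := by
  cases hρ with
  | tour d =>
    obtain _ | _ | @⟨_, _, u, _, hu, _ | _ | @⟨_, _, _, _, ⟨β, rfl⟩, h⟩⟩ := h
    exact ⟨d, isTour_of_excursions hu β (Fills.nonterminal_iff.1 h)⟩
  | empty d =>
    cases h
    exact Or.inl rfl
  | nonempty d => exact Or.inr ((Fills.nonterminal_iff (n := TourNT.hairpin d)).1 h)
  | turn d b =>
    obtain _ | ⟨_, _ | ⟨_, ⟨⟩⟩⟩ := h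
    exact ⟨[], [], b, rfl, rfl⟩
  | extend d b c =>
    obtain _ | ⟨_, _ | _ | ⟨_, ⟨α, β, b', hl, rfl⟩, _ | ⟨_, ⟨⟩⟩⟩⟩ := h
    exact ⟨b :: α, β ++ [c], b', by simp [hl], by simp⟩
  | halt d =>
    cases h
    exact ⟨[], rfl⟩
  | go d b =>
    obtain _ | ⟨_, h⟩ := h
    obtain ⟨β, rfl⟩ := Fills.nonterminal_iff.1 h
    exact ⟨b :: β, rfl⟩

theorem TourRule.derives {n : TourNT} {u : List (Symbol T TourNT)} (h : TourRule s ⟨n, u⟩) :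
    (tourGrammar s).Derives [.nonterminal n] u :=
  ContextFreeGrammar.Produces.single
    ⟨⟨n, u⟩, (finite_tourRule s).mem_toFinset.2 h, ContextFreeRule.Rewrites.input_output⟩

theorem derives_ray (d : Bool) (β : List Bool) :
    (tourGrammar s).Derives [.nonterminal (.ray d)] ((β.map (s d)).map .terminal) := by
  induction β with
  | nil => exact (TourRule.halt d).derives
  | cons b β ih => exact (TourRule.go d b).derives.trans (ih.append_left [.terminal (s d b)])

theorem derives_hairpin (d : Bool) {w : List T} (h : IsHairpin s d w) :
    (tourGrammar s).Derives [.nonterminal (.hairpin d)] (w.map .terminal) := by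
  obtain ⟨α, β, b, hl, rfl⟩ := h
  induction α generalizing β with
  | nil =>
    obtain rfl : β = [] := List.eq_nil_of_length_eq_zero hl.symm
    exact (TourRule.turn d b).derives
  | cons a α ih =>
    rcases List.eq_nil_or_concat β with rfl | ⟨β, c, rfl⟩
    · simp at hl
    · refine (TourRule.extend d a c).derives.trans ?_
      have := ((ih β (by simpa using hl)).append_left [.terminal (s d a)]).append_right
        [.terminal (s (!d) c)]
      convert this using 1
      simp
      rfl

theorem derives_excursion (d : Bool) {w : List T} (h : w = [] ∨ IsHairpin s d w) :
    (tourGrammar s).Derives [.nonterminal (.excursion d)] (w.map .terminal) := by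
  rcases h with rfl | h
  · exact (TourRule.empty d).derives
  · exact (TourRule.nonempty d).derives.trans (derives_hairpin d h)

theorem IsTour.exists_excursions {d : Bool} {w : List T} (h : IsTour s d w) :
    ∃ (u v : List T) (β : List Bool), (u = [] ∨ IsHairpin s d u) ∧
      (v = [] ∨ IsHairpin s (!d) v) ∧ w = u ++ (β.map (s !d) ++ v) := by
  obtain ⟨n, k, u, v, β, hu, hv, hl, rfl⟩ := h
  -- The middle leg has at least `n + k` letters, so pieces of lengths `n` and `k` can be cut off
  -- its two ends without overlap.
  obtain ⟨β₁, β', rfl, rfl⟩ : ∃ β₁ β', β = β₁ ++ β' ∧ n = β₁.length :=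
    ⟨β.take n, β.drop n, (List.take_append_drop n β).symm, by simp; omega⟩
  obtain ⟨β, β₂, rfl, rfl⟩ : ∃ β β₂, β' = β ++ β₂ ∧ k = β₂.length :=
    ⟨β'.take (β'.length - k), β'.drop (β'.length - k), (List.take_append_drop _ _).symm, by
      simp at hl ⊢; omega⟩
  refine ⟨u ++ β₁.map (s !d), β₂.map (s !d) ++ v, β, ?_, ?_, by simp⟩
  · generalize hn : β₁.length = n at hu
    rcases hu with _ | ⟨α, b⟩
    · left; simpa using hn
    · right; exact ⟨α, β₁, b, hn.symm, by simp⟩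
  · generalize hn : β₂.length = n at hv
    rcases hv with _ | ⟨b, γ⟩
    · left; simpa using hn
    · right; exact ⟨β₂, γ, b, hn, by simp⟩

theorem isContextFree_isTour (s : Bool → Bool → T) :
    Language.IsContextFree ({w | ∃ d, IsTour s d w} : Language T) := by
  refine ⟨tourGrammar s, Set.ext fun w => ⟨fun h => ?_, ?_⟩⟩
  · have h' := ContextFreeGrammar.fills_of_derives (P := TourNT.Generates s) (fun ρ hρ w =>
      tourRule_generates ((finite_tourRule s).mem_toFinset.1 hρ)) h
    exact (Fills.nonterminal_iff (n := TourNT.tour) (P := TourNT.Generates s)).1 h'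
  · rintro ⟨d, h⟩
    obtain ⟨u, v, β, hu, hv, rfl⟩ := h.exists_excursions
    refine (TourRule.tour d).derives.trans ?_
    rw [List.map_append, List.map_append]
    exact (derives_excursion d hu).append ((derives_ray (!d) β).append (derives_excursion _ hv))

end ContextFree

/-! ### The lamplighter group and its automata generating set -/

namespace Lamplighter

/-- The state of the lamp at `x`. -/
def lamp (g : Lamplighter 2) (x : ℤ) : ZMod 2 := g.left.toAdd x

/-- The position of the cursor. -/
def cursor (g : Lamplighter 2) : ℤ := g.right.toAdd

theorem lamp_mul (g h : Lamplighter 2) (x : ℤ) :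
    lamp (g * h) x = lamp g x + lamp h (x - cursor g) := rfl

theorem cursor_mul (g h : Lamplighter 2) : cursor (g * h) = cursor g + cursor h := rfl

theorem ext_coords {g h : Lamplighter 2} (hc : cursor g = cursor h)
    (hl : ∀ x, lamp g x = lamp h x) : g = h :=
  SemidirectProduct.ext (Multiplicative.toAdd.injective (Finsupp.ext hl))
    (Multiplicative.toAdd.injective hc)

theorem lamp_one (x : ℤ) : lamp 1 x = 0 := rfl

theorem cursor_one : cursor 1 = 0 := rfl

theorem lamp_t (x : ℤ) : lamp (t 2) x = 0 := rfl

theorem cursor_t : cursor (t 2) = 1 := rfl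

theorem lamp_a (x : ℤ) : lamp (a 2) x = if x = 0 then 1 else 0 := by
  change (Finsupp.single 0 1 : ℤ →₀ ZMod 2) x = _
  rw [Finsupp.single_apply]
  simp only [eq_comm]

theorem cursor_a : cursor (a 2) = 0 := rfl

theorem cursor_inv (g : Lamplighter 2) : cursor g⁻¹ = -cursor g := rfl

theorem lamp_inv (g : Lamplighter 2) (x : ℤ) : lamp g⁻¹ x = lamp g (x + cursor g) := by
  have := lamp_mul g g⁻¹ (x + cursor g)
  rw [mul_inv_cancel, lamp_one, add_sub_cancel_right] at this
  generalize lamp g⁻¹ x = p at *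
  generalize lamp g (x + cursor g) = q at *
  revert p q; decide

theorem a_mul_a : a 2 * a 2 = 1 :=
  ext_coords rfl fun x => by
    rw [lamp_mul, cursor_a, sub_zero, lamp_a, lamp_one]
    split_ifs <;> decide

theorem a_inv : (a 2)⁻¹ = a 2 := inv_eq_of_mul_eq_one_left a_mul_a

/-- The letter `t` or `ta`. -/
noncomputable def rightMove : Bool → Lamplighter 2
  | false => t 2
  | true => t 2 * a 2

theorem rightMove_mem (b : Bool) : rightMove b ∈ automataGens := by
  cases b
  · exact Or.inl rfl
  · exact Or.inr rfl

theorem cursor_rightMove (b : Bool) : cursor (rightMove b) = 1 := by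
  cases b <;> rfl

theorem lamp_rightMove (b : Bool) (x : ℤ) :
    lamp (rightMove b) x = if b = true ∧ x = 1 then 1 else 0 := by
  cases b
  · simp [rightMove, lamp_t]
  · simp [rightMove, lamp_mul, lamp_t, lamp_a, cursor_t, sub_eq_zero]

/-- The letters of the automata generating set. -/
noncomputable def move : Bool → Bool → Letters automataGens
  | true, b => ⟨rightMove b, Or.inl (rightMove_mem b)⟩
  | false, b => ⟨(rightMove b)⁻¹, Or.inr (by simpa using rightMove_mem b)⟩

/-- In the automata generating set every letter crosses an edge of the line and may toggle it. -/
noncomputable def edgeLamps : EdgeLamps automataGens where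
  s := move
  s_surj x := by
    have key : ∀ g ∈ automataGens, ∃ b, g = rightMove b := by
      rintro g (rfl | rfl)
      · exact ⟨false, rfl⟩
      · exact ⟨true, rfl⟩
    obtain ⟨g, hg | hg⟩ := x
    · obtain ⟨b, rfl⟩ := key g hg
      exact ⟨true, b, rfl⟩
    · obtain ⟨b, hb⟩ := key _ hg
      exact ⟨false, b, Subtype.ext (inv_eq_iff_eq_inv.1 hb)⟩
  s_mul_inv d b := by
    cases d
    · exact inv_mul_cancel _
    · exact mul_inv_cancel _
  c := cursor
  f := lamp
  coords_ext g h := ext_coords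
  c_mul := cursor_mul
  f_mul := lamp_mul
  c_right := cursor_rightMove
  c_left b := by
    change cursor (rightMove b)⁻¹ = -1
    rw [cursor_inv, cursor_rightMove]
  f_right := lamp_rightMove
  f_left b x := by
    change lamp (rightMove b)⁻¹ x = _
    rw [lamp_inv, cursor_rightMove, lamp_rightMove]
    simp

theorem fullGeodesicLanguage_automataGens :
    fullGeodesicLanguage automataGens = {w | ∃ d, IsTour move d w} :=
  Set.ext fun w => edgeLamps.isGeodesicWord_iff w

end Lamplighter

/-! ### The swapping lemma for automata over abelian groups -/

section Swapping

namespace GroupAutomaton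

variable {G A : Type*} [Group G] {M : GroupAutomaton G A}

theorem Path.trans {q r s : M.State} {u v : List A} {g h : G} (h₁ : M.Path q u g r)
    (h₂ : M.Path r v h s) : M.Path q (u ++ v) (g * h) s := by
  induction h₁ with
  | nil => simpa using h₂
  | cons he _ ih =>
    rw [List.append_assoc, mul_assoc]
    exact .cons he (ih h₂)

theorem Path.exists_split {q r : M.State} {u v : List A} {g : G} (h : M.Path q (u ++ v) g r) :
    ∃ (s : M.State) (g₁ g₂ : G), M.Path q u g₁ s ∧ M.Path s v g₂ r ∧ g = g₁ * g₂ := by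
  generalize hw : u ++ v = w at h
  induction h generalizing u with
  | nil q =>
    obtain ⟨rfl, rfl⟩ := List.append_eq_nil_iff.1 hw
    exact ⟨q, 1, 1, .nil q, .nil q, (mul_one 1).symm⟩
  | @cons q q' r x g h w he hp ih =>
    rcases u with _ | ⟨y, u⟩
    · exact ⟨q, 1, g * h, .nil q, by rw [List.nil_append] at hw; exact hw ▸ .cons he hp,
        (one_mul _).symm⟩
    · cases x with
      | none =>
        obtain ⟨s, g₁, g₂, h1, h2, rfl⟩ := ih hw
        exact ⟨s, g * g₁, g₂, .cons he h1, h2, (mul_assoc _ _ _).symm⟩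
      | some x =>
        simp only [Option.toList_some, List.cons_append, List.nil_append, List.cons.injEq] at hw
        obtain ⟨rfl, hw⟩ := hw
        obtain ⟨s, g₁, g₂, h1, h2, rfl⟩ := ih hw
        exact ⟨s, g * g₁, g₂, .cons he h1, h2, (mul_assoc _ _ _).symm⟩

end GroupAutomaton

/-- The concatenation of the words `b i, …, b (j - 1)`. -/
def blocks {A : Type*} (b : ℕ → List A) (i : ℕ) : ℕ → List A
  | 0 => []
  | j + 1 => if i ≤ j then blocks b i j ++ b j else []

section Blocks

variable {A : Type*} (b : ℕ → List A)

theorem blocks_succ {i j : ℕ} (h : i ≤ j) : blocks b i (j + 1) = blocks b i j ++ b j := if_pos h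

theorem blocks_self (i : ℕ) : blocks b i i = [] := by
  cases i with
  | zero => rfl
  | succ i => exact if_neg (by omega)

theorem blocks_append {i j k : ℕ} (hij : i ≤ j) (hjk : j ≤ k) :
    blocks b i j ++ blocks b j k = blocks b i k := by
  induction k, hjk using Nat.le_induction with
  | base => rw [blocks_self, List.append_nil]
  | succ k hjk ih =>
    rw [blocks_succ b hjk, blocks_succ b (hij.trans hjk), ← List.append_assoc, ih]

end Blocks

namespace GroupAutomaton

variable {G A : Type*} [Group G] {M : GroupAutomaton G A}

/-- Here `c i` is the label of the path up to block `i`; written as `(c i)⁻¹ * c (i + 1)`, the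
labels of consecutive blocks telescope. -/
theorem Path.exists_states {q r : M.State} {b : ℕ → List A} {n : ℕ} {z : List A} {g : G}
    (h : M.Path q (blocks b 0 n ++ z) g r) :
    ∃ (s : ℕ → M.State) (c : ℕ → G), s 0 = q ∧ c 0 = 1 ∧
      (∀ i < n, M.Path (s i) (b i) ((c i)⁻¹ * c (i + 1)) (s (i + 1))) ∧
      M.Path (s n) z ((c n)⁻¹ * g) r := by
  induction n generalizing z with
  | zero => exact ⟨fun _ => q, fun _ => 1, rfl, rfl, by simp, by simpa [blocks] using h⟩
  | succ n ih =>
    rw [blocks_succ b (Nat.zero_le _), List.append_assoc] at h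
    obtain ⟨s, c, hs, hc, h1, h2⟩ := ih h
    obtain ⟨p, g₁, g₂, hp₁, hp₂, he⟩ := h2.exists_split
    refine ⟨Function.update s (n + 1) p, Function.update c (n + 1) (c n * g₁), by simpa using hs,
      by simpa using hc, fun i hi => ?_, ?_⟩
    · rcases Nat.lt_succ_iff_lt_or_eq.1 hi with hi | rfl
      · rw [Function.update_of_ne (by omega), Function.update_of_ne (by omega),
          Function.update_of_ne (by omega), Function.update_of_ne (by omega)]
        exact h1 i hi
      · simpa using hp₁
    · have : (c n * g₁)⁻¹ * g = g₂ := by rw [mul_inv_rev, mul_assoc, he]; simp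
      rwa [Function.update_self, Function.update_self, this]

theorem path_blocks {b : ℕ → List A} {n : ℕ} {s : ℕ → M.State} {c : ℕ → G}
    (h : ∀ i < n, M.Path (s i) (b i) ((c i)⁻¹ * c (i + 1)) (s (i + 1))) {i j : ℕ} (hij : i ≤ j)
    (hj : j ≤ n) : M.Path (s i) (blocks b i j) ((c i)⁻¹ * c j) (s j) := by
  induction j, hij using Nat.le_induction with
  | base => rw [blocks_self, inv_mul_cancel]; exact .nil _
  | succ j hij ih =>
    rw [blocks_succ b hij]
    convert (ih (by omega)).trans (h j (by omega)) using 1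
    group

/-- Swapping lemma: in a long enough product of blocks accepted by an automaton over an abelian
group, two consecutive products of blocks can be exchanged. -/
theorem exists_swap {G A : Type*} [CommGroup G] (M : GroupAutomaton G A) :
    ∃ n : ℕ, ∀ (b : ℕ → List A) (z : List A), blocks b 0 n ++ z ∈ M.language →
      ∃ i j k, i < j ∧ j < k ∧ k ≤ n ∧
        blocks b 0 i ++ (blocks b j k ++ (blocks b i j ++ (blocks b k n ++ z))) ∈ M.language := by
  classical
  have := M.finite_state
  have := Fintype.ofFinite M.State
  -- The `2 * card + 1` block boundaries put three visits on one state, which gives two consecutive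
  -- loops.
  refine ⟨Fintype.card M.State * 2, fun b z => ?_⟩
  set n := Fintype.card M.State * 2 with hn
  rintro ⟨r, hr, hp⟩
  obtain ⟨s, c, hs, hc, h, hz⟩ := hp.exists_states
  obtain ⟨q, -, hq⟩ := Finset.exists_lt_card_fiber_of_mul_lt_card_of_maps_to
    (s := Finset.range (n + 1)) (t := Finset.univ) (f := s) (n := 2) (fun _ _ => Finset.mem_univ _)
    (by rw [Finset.card_univ, Finset.card_range]; omega)
  obtain ⟨i, j, k, hij, hjk, hk, hsi, hsk⟩ : ∃ i j k, i < j ∧ j < k ∧ k ≤ n ∧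
      s i = s j ∧ s k = s j := by
    obtain ⟨F, hF, hF3⟩ := Finset.exists_subset_card_eq (Nat.succ_le_of_lt hq)
    let e := F.orderEmbOfFin hF3
    have he : ∀ x, e x ≤ n ∧ s (e x) = q := fun x => by
      have := hF (F.orderEmbOfFin_mem hF3 x)
      rw [Finset.mem_filter, Finset.mem_range] at this
      exact ⟨Nat.le_of_lt_succ this.1, this.2⟩
    exact ⟨e 0, e 1, e 2, e.lt_iff_lt.2 (by decide), e.lt_iff_lt.2 (by decide), (he 2).1,
      (he 0).2.trans (he 1).2.symm, (he 2).2.trans (he 1).2.symm⟩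
  refine ⟨i, j, k, hij, hjk, hk, r, hr, ?_⟩
  have h1 := path_blocks h (Nat.zero_le i) (by omega)
  have h2 := path_blocks h hij.le (by omega)
  have h3 := path_blocks h hjk.le hk
  have h4 := path_blocks h hk le_rfl
  rw [hs, hsi] at h1
  rw [hsi] at h2
  rw [hsk] at h3 h4
  convert h1.trans (h3.trans (h2.trans (h4.trans hz))) using 1
  rw [hc, mul_left_comm ((c j)⁻¹ * c k)]
  group

end GroupAutomaton

end Swapping

theorem exists_wordValue_eq_inv {G : Type*} [Group G] {S : Set G} (v : List (Letters S)) :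
    ∃ v' : List (Letters S), wordValue v' = (wordValue v)⁻¹ ∧ v'.length = v.length := by
  induction v with
  | nil => exact ⟨[], by simp [wordValue_nil], rfl⟩
  | cons x v ih =>
    obtain ⟨v', h, hl⟩ := ih
    refine ⟨v' ++ [⟨x.1⁻¹, by simpa using x.2.symm⟩], ?_, by simp [hl]⟩
    rw [wordValue_append, wordValue_singleton, wordValue_cons, h, mul_inv_rev]

/-! ### The wreath product generating set -/

namespace Lamplighter

/-- The letter `a`. -/
noncomputable def toggle : Letters (wreathGens 2) := ⟨a 2, Or.inl (Or.inl rfl)⟩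

/-- The letter `t`. -/
noncomputable def right : Letters (wreathGens 2) := ⟨t 2, Or.inl (Or.inr rfl)⟩

/-- The letter `t⁻¹`. -/
noncomputable def left : Letters (wreathGens 2) :=
  ⟨(t 2)⁻¹, Or.inr (Or.inr (inv_inv (t 2)))⟩

theorem letter_cases (x : Letters (wreathGens 2)) : x = toggle ∨ x = right ∨ x = left := by
  obtain ⟨g, (h | h) | (h | h)⟩ := x
  · exact Or.inl (Subtype.ext h)
  · exact Or.inr (Or.inl (Subtype.ext h))
  · exact Or.inl (Subtype.ext ((inv_eq_iff_eq_inv.1 h).trans a_inv))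
  · exact Or.inr (Or.inr (Subtype.ext (inv_eq_iff_eq_inv.1 h)))

/-- Every word has at least as many letters as are needed to toggle the lit lamps and to walk
to the rightmost position and to the final one. -/
theorem exists_litSet (v : List (Letters (wreathGens 2))) :
    ∃ (F : Finset ℤ) (M : ℤ), 0 ≤ M ∧ cursor (wordValue v) ≤ M ∧
      (∀ x, lamp (wordValue v) x ≠ 0 → x ∈ F) ∧ (∀ x ∈ F, x ≤ M) ∧
      F.card + 2 * M - cursor (wordValue v) ≤ v.length := by
  induction v using List.reverseRecOn with
  | nil => exact ⟨∅, 0, le_rfl, by simp [wordValue_nil, cursor_one],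
      by simp [wordValue_nil, lamp_one], by simp, by simp [wordValue_nil, cursor_one]⟩
  | append_singleton v x ih =>
    obtain ⟨F, M, hM, hc, hF, hFM, hl⟩ := ih
    rw [wordValue_append, wordValue_singleton, List.length_append, List.length_singleton,
      cursor_mul]
    -- No letter raises `F.card + 2 * M - c` by more than one: a toggle adds at most one point to
    -- `F`, a left step lowers `c`, and a right step past `M` costs `2 - 1`.
    rcases letter_cases x with rfl | rfl | rfl
    · have h0 : cursor toggle.1 = 0 := cursor_a
      refine ⟨insert (cursor (wordValue v)) F, M, hM, by omega, fun x hx => ?_, ?_, ?_⟩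
      · rw [Finset.mem_insert, or_iff_not_imp_left]
        intro hne
        refine hF x ?_
        rwa [lamp_mul, show toggle.1 = a 2 from rfl, lamp_a, if_neg (by omega), add_zero] at hx
      · intro x hx
        rcases Finset.mem_insert.1 hx with rfl | hx
        · exact hc
        · exact hFM x hx
      · have := Finset.card_insert_le (cursor (wordValue v)) F
        push_cast
        omega
    · have h0 : cursor right.1 = 1 := cursor_t
      refine ⟨F, max M (cursor (wordValue v) + 1), by omega, by omega, fun x hx => hF x ?_,
        fun x hx => ?_, ?_⟩
      · rwa [lamp_mul, show right.1 = t 2 from rfl, lamp_t, add_zero] at hx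
      · have := hFM x hx
        omega
      · push_cast
        omega
    · have h0 : cursor left.1 = -1 := rfl
      refine ⟨F, M, by omega, by omega, fun x hx => hF x ?_, hFM, ?_⟩
      · rwa [lamp_mul, show left.1 = (t 2)⁻¹ from rfl, lamp_inv, lamp_t, add_zero] at hx
      · push_cast
        omega

/-- One toggle for each of the `n` lamps, and `2n` steps to reach the last one and return. -/
theorem three_mul_le_length {v : List (Letters (wreathGens 2))} {n : ℕ}
    (hc : cursor (wordValue v) = 0)
    (hl : ∀ x ∈ Finset.Ioc (0 : ℤ) n, lamp (wordValue v) x ≠ 0) : 3 * n ≤ v.length := by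
  obtain ⟨F, M, hM, -, hF, hFM, hlen⟩ := exists_litSet v
  have hsub : Finset.Ioc (0 : ℤ) n ⊆ F := fun x hx => hF x (hl x hx)
  have hcard := Finset.card_le_card hsub
  rw [Int.card_Ioc] at hcard
  have hnM : (n : ℤ) ≤ M := by
    rcases Nat.eq_zero_or_pos n with rfl | hn
    · simpa using hM
    · exact hFM _ (hsub (Finset.mem_Ioc.2 ⟨by omega, le_rfl⟩))
  omega

/-- `v` is a word that walks `n` steps to the right and toggles exactly the lamps of `F`, once each
and each of them after a step. -/
structure IsForward (v : List (Letters (wreathGens 2))) (F : Finset ℤ) (n : ℕ) : Prop where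
  lamp_eq : ∀ x, lamp (wordValue v) x = if x ∈ F then 1 else 0
  cursor_eq : cursor (wordValue v) = n
  subset : F ⊆ Finset.Ioc 0 (n : ℤ)
  length_eq : v.length = n + F.card

theorem IsForward.nil : IsForward [] ∅ 0 :=
  ⟨fun x => by simp [wordValue_nil, lamp_one], by simp [wordValue_nil, cursor_one], by simp, rfl⟩

theorem IsForward.right : IsForward [right] ∅ 1 :=
  ⟨fun x => by rw [wordValue_singleton]; exact lamp_t x,
    by rw [wordValue_singleton]; exact cursor_t, by simp, rfl⟩

theorem IsForward.right_toggle : IsForward [Lamplighter.right, toggle] {1} 1 := by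
  have h : wordValue [Lamplighter.right, toggle] = t 2 * a 2 := by
    rw [wordValue_cons, wordValue_singleton]; rfl
  refine ⟨fun x => ?_, ?_, by simp, rfl⟩ <;> rw [h]
  · rw [lamp_mul, lamp_t, lamp_a, cursor_t]
    simp [sub_eq_zero]
  · rw [cursor_mul, cursor_t, cursor_a]; rfl

theorem IsForward.append {u v : List (Letters (wreathGens 2))} {F F' : Finset ℤ} {n m : ℕ}
    (hu : IsForward u F n) (hv : IsForward v F' m) :
    IsForward (u ++ v) (F ∪ F'.map (addRightEmbedding (n : ℤ))) (n + m) := by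
  -- Toggles come only after steps, so `u` owns the lamps in `(0, n]` and `v` those beyond `n`.
  have hdisj : Disjoint F (F'.map (addRightEmbedding (n : ℤ))) := by
    rw [Finset.disjoint_left]
    intro x hx hx'
    obtain ⟨y, hy, rfl⟩ := Finset.mem_map.1 hx'
    have h1 := Finset.mem_Ioc.1 (hu.subset hx)
    have h2 := Finset.mem_Ioc.1 (hv.subset hy)
    simp only [addRightEmbedding_apply] at h1
    omega
  have hmem : ∀ x, x ∈ F'.map (addRightEmbedding (n : ℤ)) ↔ x - n ∈ F' := fun x => by
    simp [Finset.mem_map, ← eq_sub_iff_add_eq]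
  refine ⟨fun x => ?_, ?_, ?_, ?_⟩
  · rw [wordValue_append, lamp_mul, hu.lamp_eq, hu.cursor_eq, hv.lamp_eq]
    simp only [Finset.mem_union, hmem]
    have this : x ∈ F → x - n ∉ F' := fun h h' => Finset.disjoint_left.1 hdisj h ((hmem x).2 h')
    by_cases h1 : x ∈ F
    · simp [h1, this h1]
    · simp [h1]
  · rw [wordValue_append, cursor_mul, hu.cursor_eq, hv.cursor_eq]
    push_cast; rfl
  · intro x hx
    rw [Finset.mem_Ioc]
    rcases Finset.mem_union.1 hx with h | h
    · have := Finset.mem_Ioc.1 (hu.subset h)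
      push_cast; omega
    · have := Finset.mem_Ioc.1 (hv.subset ((hmem x).1 h))
      push_cast; omega
  · rw [List.length_append, hu.length_eq, hv.length_eq, Finset.card_union_of_disjoint hdisj,
      Finset.card_map]
    omega

theorem exists_isForward {n : ℕ} {F : Finset ℤ} (hF : F ⊆ Finset.Ioc 0 (n : ℤ)) :
    ∃ v, IsForward v F n := by
  induction n generalizing F with
  | zero =>
    obtain rfl : F = ∅ := Finset.subset_empty.1 (by simpa using hF)
    exact ⟨[], .nil⟩
  | succ n ih =>
    have hF' : F.erase (n + 1) ⊆ Finset.Ioc 0 (n : ℤ) := fun x hx => by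
      rw [Finset.mem_erase] at hx
      have := Finset.mem_Ioc.1 (hF hx.2)
      rw [Finset.mem_Ioc]
      push_cast at this
      omega
    obtain ⟨v, hv⟩ := ih hF'
    by_cases h : (n + 1 : ℤ) ∈ F
    · refine ⟨v ++ [right, toggle], ?_⟩
      convert hv.append .right_toggle using 1
      ext x
      simp only [Finset.mem_union, Finset.mem_erase, Finset.map_singleton, Finset.mem_singleton,
        addRightEmbedding_apply]
      by_cases hx : x = n + 1
      · subst hx; simp [h, add_comm]
      · have : ¬ x = 1 + n := by omega
        simp [hx, this]
    · refine ⟨v ++ [right], ?_⟩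
      convert hv.append .right using 1
      rw [Finset.erase_eq_of_notMem h]
      simp

/-- The word `t ^ (i + 1) * a`. -/
noncomputable def spacedBlock (i : ℕ) : List (Letters (wreathGens 2)) :=
  List.replicate i right ++ [right, toggle]

theorem isForward_replicate (i : ℕ) : IsForward (List.replicate i right) ∅ i := by
  induction i with
  | zero => exact .nil
  | succ i ih =>
    rw [List.replicate_succ']
    simpa using ih.append .right

theorem isForward_spacedBlock (i : ℕ) : IsForward (spacedBlock i) {(i : ℤ) + 1} (i + 1) := by
  have := (isForward_replicate i).append .right_toggle
  rw [spacedBlock]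
  simpa [add_comm] using this

theorem exists_isForward_blocks {i j : ℕ} (h : i ≤ j) :
    ∃ F n, IsForward (blocks spacedBlock i j) F n := by
  induction j, h using Nat.le_induction with
  | base => exact ⟨∅, 0, by rw [blocks_self]; exact .nil⟩
  | succ j h ih =>
    obtain ⟨F, n, hF⟩ := ih
    rw [blocks_succ _ h]
    exact ⟨_, _, hF.append (isForward_spacedBlock j)⟩

theorem lamp_spacedBlock_append {v : List (Letters (wreathGens 2))} {F : Finset ℤ} {n : ℕ}
    (hv : IsForward v F n) {i : ℕ} {x : ℤ} (hx : x ≤ i + 1) :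
    lamp (wordValue (spacedBlock i ++ v)) x = if x = i + 1 then 1 else 0 := by
  have hb := isForward_spacedBlock i
  have : x - (i + 1 : ℕ) ∉ F := fun h => by
    have := Finset.mem_Ioc.1 (hv.subset h)
    push_cast at this
    omega
  rw [wordValue_append, lamp_mul, hb.lamp_eq, hb.cursor_eq, hv.lamp_eq, if_neg this, add_zero]
  simp only [Finset.mem_singleton]

theorem blocks_eq_spacedBlock_append {i j : ℕ} (h : i < j) :
    blocks spacedBlock i j = spacedBlock i ++ blocks spacedBlock (i + 1) j := by
  rw [← blocks_append _ (Nat.le_succ i) h, blocks_succ _ le_rfl, blocks_self, List.nil_append]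

/-- The leftmost lit lamp tells which block came first: it is at `i + 1` in one order and at `j + 1`
in the other. -/
theorem wordValue_blocks_swap_ne {i j k : ℕ} (hij : i < j) (hjk : j < k) :
    wordValue (blocks spacedBlock j k ++ blocks spacedBlock i j) ≠
      wordValue (blocks spacedBlock i j ++ blocks spacedBlock j k) := by
  intro h
  have h1 := congrArg (fun g => lamp g (i + 1)) h
  obtain ⟨F₁, n₁, hF₁⟩ := exists_isForward_blocks (i := i + 1) (j := k) (by omega)
  obtain ⟨F₂, n₂, hF₂⟩ := exists_isForward_blocks (i := j + 1) (j := k) (by omega)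
  obtain ⟨F₃, n₃, hF₃⟩ := exists_isForward_blocks hij.le
  beta_reduce at h1
  rw [blocks_append _ hij.le hjk.le, blocks_eq_spacedBlock_append (hij.trans hjk),
    blocks_eq_spacedBlock_append hjk, List.append_assoc,
    lamp_spacedBlock_append (hF₂.append hF₃) (by omega), lamp_spacedBlock_append hF₁ le_rfl,
    if_neg (by omega), if_pos rfl] at h1
  exact zero_ne_one h1

/-- The value of a forward word followed by a return that toggles the lamps of `C`. -/
theorem lamp_forward_return {u v z : List (Letters (wreathGens 2))} {F C : Finset ℤ} {n : ℕ}
    (hu : IsForward u F n) (hv : IsForward v C n) (hz : wordValue z = (wordValue v)⁻¹) (x : ℤ) :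
    lamp (wordValue (u ++ z)) x = (if x ∈ F then 1 else 0) + if x ∈ C then 1 else 0 := by
  rw [wordValue_append, lamp_mul, hz, lamp_inv, hu.lamp_eq, hu.cursor_eq, hv.cursor_eq,
    sub_add_cancel, hv.lamp_eq]

theorem cursor_forward_return {u v z : List (Letters (wreathGens 2))} {F C : Finset ℤ} {n : ℕ}
    (hu : IsForward u F n) (hv : IsForward v C n) (hz : wordValue z = (wordValue v)⁻¹) :
    cursor (wordValue (u ++ z)) = 0 := by
  rw [wordValue_append, cursor_mul, hz, cursor_inv, hu.cursor_eq, hv.cursor_eq, add_neg_cancel]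

/-- An element with cursor at the origin whose lit lamps are among those at `1, …, n`, but not all
of these, is represented by a word with less than `3 * n` letters. -/
theorem exists_short_word {g : Lamplighter 2} {n : ℕ} (hc : cursor g = 0)
    (hg : ∀ x, lamp g x ≠ 0 → x ∈ Finset.Ioc 0 (n : ℤ))
    (hne : ∃ x ∈ Finset.Ioc 0 (n : ℤ), lamp g x = 0) :
    ∃ v : List (Letters (wreathGens 2)), wordValue v = g ∧ v.length < 3 * n := by
  set D := (Finset.Ioc 0 (n : ℤ)).filter fun x => lamp g x ≠ 0 with hD
  have hcard : D.card < n := by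
    have : D ⊂ Finset.Ioc 0 (n : ℤ) := by
      rw [Finset.ssubset_iff_subset_ne]
      refine ⟨Finset.filter_subset _ _, fun h => ?_⟩
      obtain ⟨x, hx, h0⟩ := hne
      rw [← h, hD, Finset.mem_filter] at hx
      exact hx.2 h0
    simpa using Finset.card_lt_card this
  obtain ⟨v, hv⟩ := exists_isForward (hD ▸ Finset.filter_subset _ _ : D ⊆ Finset.Ioc 0 (n : ℤ))
  have hr := isForward_replicate n
  -- Toggle the lamps of `D` on the way out and return without toggling: `D.card + 2 * n` letters.
  obtain ⟨z, hz, hl⟩ := exists_wordValue_eq_inv (List.replicate n right)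
  refine ⟨v ++ z, ext_coords ?_ fun x => ?_, ?_⟩
  · rw [cursor_forward_return hv hr hz, hc]
  · rw [lamp_forward_return hv hr hz]
    have h2 : ∀ p : ZMod 2, p ≠ 0 → p = 1 := by decide
    by_cases hx : lamp g x = 0
    · simp [hD, hx]
    · have := Finset.mem_Ioc.1 (hg x hx)
      simp [hD, h2 _ hx, this]
  · rw [List.length_append, hl, hv.length_eq, hr.length_eq, Finset.card_empty]
    omega

theorem not_isCounter_wreathGens : ¬ (fullGeodesicLanguage (wreathGens 2)).IsCounter := by
  rintro ⟨d, -, M, hM⟩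
  obtain ⟨n, hn⟩ := M.exists_swap
  obtain ⟨F, T, hF⟩ := exists_isForward_blocks (Nat.zero_le n)
  -- The return `z` is an inverse of a forward word toggling the complement of `F`, so the round
  -- trip lights each lamp in `(0, T]` once.
  obtain ⟨v, hv⟩ := exists_isForward (Finset.sdiff_subset : Finset.Ioc 0 (T : ℤ) \ F ⊆ _)
  obtain ⟨z, hz, hlz⟩ := exists_wordValue_eq_inv v
  have hlamp : ∀ x, lamp (wordValue (blocks spacedBlock 0 n ++ z)) x =
      if x ∈ Finset.Ioc 0 (T : ℤ) then 1 else 0 := fun x => by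
    rw [lamp_forward_return hF hv hz]
    by_cases h1 : x ∈ F
    · simp only [Finset.mem_sdiff, h1, hF.subset h1]; simp
    · simp only [Finset.mem_sdiff, h1]; simp
  have hcursor := cursor_forward_return hF hv hz
  have hlen : (blocks spacedBlock 0 n ++ z).length = 3 * T := by
    have h1 := Finset.card_sdiff_add_card_eq_card hF.subset
    rw [Int.card_Ioc] at h1
    rw [List.length_append, hlz, hF.length_eq, hv.length_eq]
    omega
  have hgeo : blocks spacedBlock 0 n ++ z ∈ M.language := by
    rw [hM]
    intro w hw
    rw [hlen]
    refine three_mul_le_length (by rw [hw, hcursor]) fun x hx => ?_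
    rw [hw, hlamp, if_pos hx]
    exact one_ne_zero
  obtain ⟨i, j, k, hij, hjk, hk, hswap⟩ := hn _ _ hgeo
  rw [hM] at hswap
  have hsplit : blocks spacedBlock 0 n = blocks spacedBlock 0 i ++ (blocks spacedBlock i j ++
      (blocks spacedBlock j k ++ blocks spacedBlock k n)) := by
    rw [blocks_append _ hjk.le hk, blocks_append _ hij.le (by omega),
      blocks_append _ (Nat.zero_le i) (by omega)]
  obtain ⟨F₁, T₁, h₁⟩ := exists_isForward_blocks (Nat.zero_le i)
  obtain ⟨F₂, T₂, h₂⟩ := exists_isForward_blocks hij.le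
  obtain ⟨F₃, T₃, h₃⟩ := exists_isForward_blocks hjk.le
  obtain ⟨F₄, T₄, h₄⟩ := exists_isForward_blocks hk
  have hT := hF.cursor_eq
  rw [hsplit, (h₁.append (h₂.append (h₃.append h₄))).cursor_eq] at hT
  obtain ⟨F', hF'⟩ : ∃ F', IsForward (blocks spacedBlock 0 i ++ (blocks spacedBlock j k ++
      (blocks spacedBlock i j ++ blocks spacedBlock k n))) F' T := by
    have h := h₁.append (h₃.append (h₂.append h₄))
    rw [show T₁ + (T₃ + (T₂ + T₄)) = T by omega] at h
    exact ⟨_, h⟩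
  set u := blocks spacedBlock 0 i ++ (blocks spacedBlock j k ++
      (blocks spacedBlock i j ++ blocks spacedBlock k n)) with hu
  have hswap' : u ++ z ∈ fullGeodesicLanguage (wreathGens 2) := by
    simpa [hu] using hswap
  have hulen : (u ++ z).length = 3 * T := by
    rw [← hlen, hsplit, hu]
    simp only [List.length_append]
    omega
  -- If all lamps stayed lit, the swapped word would have the original value, and cancelling the
  -- common prefix and suffix would make the two exchanged products equal.
  have hne : ∃ x ∈ Finset.Ioc 0 (T : ℤ), lamp (wordValue (u ++ z)) x = 0 := by
    by_contra! hall
    have heq : wordValue (u ++ z) = wordValue (blocks spacedBlock 0 n ++ z) := by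
      refine ext_coords (by rw [hcursor, cursor_forward_return hF' hv hz]) fun x => ?_
      rw [hlamp]
      split_ifs with hx
      · have h2 : ∀ p : ZMod 2, p ≠ 0 → p = 1 := by decide
        exact h2 _ (hall x hx)
      · rw [lamp_forward_return hF' hv hz, if_neg fun h => hx (hF'.subset h),
          if_neg fun h => hx (hv.subset h), add_zero]
    rw [hsplit, hu] at heq
    refine wordValue_blocks_swap_ne hij hjk ?_
    simp only [wordValue_append, ← mul_assoc, mul_left_inj] at heq ⊢
    simpa only [mul_assoc, mul_right_inj] using heq
  obtain ⟨w, hw, hlw⟩ := exists_short_word (cursor_forward_return hF' hv hz) (fun x hx => by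
    rw [lamp_forward_return hF' hv hz] at hx
    by_contra hx'
    rw [if_neg fun h => hx' (hF'.subset h), if_neg fun h => hx' (hv.subset h), add_zero] at hx
    exact hx rfl) hne
  have := hswap' w hw
  omega

end Lamplighter

theorem mainTheorem7 :
    (fullGeodesicLanguage Lamplighter.automataGens).IsKCounter 1 ∧
    (fullGeodesicLanguage Lamplighter.automataGens).IsContextFree ∧
    (fullGeodesicLanguage Lamplighter.automataGens).IsCounter ∧
    ¬ (fullGeodesicLanguage (Lamplighter.wreathGens 2)).IsCounter := by
  have h : (fullGeodesicLanguage Lamplighter.automataGens).IsKCounter 1 := by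
    rw [Lamplighter.fullGeodesicLanguage_automataGens]
    exact isKCounter_isTour _
  refine ⟨h, ?_, ⟨1, le_rfl, h⟩, Lamplighter.not_isCounter_wreathGens⟩
  rw [Lamplighter.fullGeodesicLanguage_automataGens]
  exact isContextFree_isTour _
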